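/- **Setting.** Let $d\ge 1$, $T>0$, $m\ge 2$. Let $(\Omega,\mathcal F,\mathbb P)$ be a complete probability space with a filtration $\{\mathcal F_t\}_{t\ge0}$ such that $\mathcal F_0$ contains all $\mathbb P$-null sets; write $\mathbb E^{\mathcal F_s}$ for the conditional expectation given $\mathcal F_s$ and $L_m=L^m(\Omega,\mathcal F,\mathbb P)$. Let $(\mathcal H,\|\cdot\|_{\mathcal H})$ be a real normed space of tempered distributions on $\mathbb R^d$ which contains $C_b(\mathbb R^d)$. For $q\in[1,\infty]$, $L^q_T\mathcal H=L^q([0,T];\mathcal H)$ is the Bochner space of strongly Lebesgue-measurable functions $f:[0,T]\to\mathcal H$ with its usual norm. *Condition 3.1.* Let $X=\{X_t\}_{t\ge0}$ be a Markov process in $\mathbb R^d$ with respect to $\{\mathcal F_t\}$ with Lebesgue-measurable sample paths, $U=\{U_{s,t}\}_{0\le s\le t}$ a family of bounded linear operators on $\mathcal H$, and $\nu\le0$. We say that $(X,U,\mathcal H)$ satisfies Condition 3.1 with $\nu$ if (i) for all $h\in\mathcal H$ and $0\le s<t\le T$, $U_{s,t}h$ is a bounded continuous function on $\mathbb R^d$,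 and there is a finite $K\ge0$, independent of $h,s,t$, with $\|U_{s,t}h\|_\infty\le K\|h\|_{\mathcal H}|t-s|^{\nu/2}$; the smallest such $K$ is denoted by $\|U\|_{\mathcal H,\nu}$; (ii) for all $s\ge0$, $x\in\mathbb R^d$, $h\in\mathcal H$, the map $r\mapsto U_{s,r}h(x)$ is Lebesgue measurable on $(s,T]$; (iii) for all $0\le s\le r<t\le T$ and $h\in\mathcal H$, $\mathbb E^{\mathcal F_s}\big([U_{r,t}h](X_r)\big)=U_{s,t}h(X_s)$ a.s. *The functional $\mathcal A^X[f]$.* For $f\in L^q_T\mathcal H$ put $A^X_{s,t}[f]=\int_{[s,t]}U_{s,r}f_r(X_s)\,dr$, $0\le s\le t\le T$. Then $\mathcal A^X[f]=(\mathcal A^X_t[f])_{0\le t\le T}$ denotes the unique (up to modifications) real process $\varphi$ which is $\{\mathcal F_t\}$-adapted, $L_m$-integrable, with $\varphi_0=0$, and for which there are $\varepsilon>0$ and $K<\infty$ such that for all $0\le s\le t\le T$ $$\|\varphi_t-\varphi_s\|_{L_m}\le K|t-s|^{\frac12+\varepsilon},\qquad \|\mathbb E^{\mathcal F_s}(\varphi_t-\varphi_s-A^X_{s,t}[f])\|_{L_m}\le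 K|t-s|^{1+\varepsilon}.$$ *Distances.* Let $(X,U^X,\mathcal H)$ and $(Y,U^Y,\mathcal H)$ satisfy Condition 3.1 with the same $\nu\le 0$ and with respect to the same filtration. Let $\|U^X-U^Y\|_{\mathcal H,\nu}$ be the smallest $M$ with $\|(U^X_{s,t}-U^Y_{s,t})\phi\|_\infty\le M\|\phi\|_{\mathcal H}|t-s|^{\nu/2}$ for all $\phi\in\mathcal H$, $0\le s<t\le T$. For $\nu_1\le0$ and $h\ge0$ put $$\rho^X_{\nu_1}(h)=\sup_{\|\phi\|_{\mathcal H}\le1}\ \sup_{0\le s<t\le T}\ \sup_{|x-y|\le h}\frac{|U^X_{s,t}\phi(x)-U^X_{s,t}\phi(y)|}{|t-s|^{\nu_1/2}},$$ $$D_{\nu,\nu_1}(X,Y)=\|U^X-U^Y\|_{\mathcal H,\nu}+\sup_{r\in[0,T]}\big\|\rho^X_{\nu_1}(|X_r-Y_r|)\big\|_{L_m}\in[0,\infty].$$ **Proposition 3.9.** Let $m\ge 2$, $T>0$, $q\in(2,\infty]$ and $\nu,\nu_1\le0$ satisfy $\frac\nu2-\frac1q>-\frac12$ and $\frac{\nu_1}2-\frac1q>-\frac12$.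 There is a constant $C$, depending only on $m,T,q,\nu,\nu_1$, such that the following holds for all data as above. Suppose that $(X,U^X,\mathcal H)$ and $(Y,U^Y,\mathcal H)$ satisfy Condition 3.1 with the same $\nu$, and that $\rho^X_{\nu_1}(h)$ is finite for every $h>0$. Then for every $f,g\in L^q_T\mathcal H$ the processes $\mathcal A^X[g]$ and $\mathcal A^Y[f]$ are well defined (existence and uniqueness up to modifications), and for every $0\le s\le t\le T$ $$\big\|\mathcal A^X_t[g]-\mathcal A^X_s[g]-\mathcal A^Y_t[f]+\mathcal A^Y_s[f]\big\|_{L_m}\le C\Big(\|f-g\|_{L^q_T\mathcal H}\|U^X\|_{\mathcal H,\nu}+\|f\|_{L^q_T\mathcal H}D_{\nu,\nu_1}(X,Y)\Big)|t-s|^{1+\frac{\nu\wedge\nu_1}2-\frac1q},$$ with the convention $0\cdot\infty=0$ on the right-hand side. -/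

import Mathlib

open MeasureTheory ProbabilityTheory Filter Topology
open scoped ENNReal NNReal SchwartzMap BoundedContinuousFunction

noncomputable section

namespace DistFunctional

/-- The space `ℝ^d` with the Euclidean norm. -/
abbrev Rd (d : ℕ) : Type := EuclideanSpace ℝ (Fin d)

/-- A normed space `𝓗` of (real) tempered distributions on `ℝ^d` which contains all bounded
continuous functions. The inclusion of `𝓗` in `𝓢'(ℝ^d)` is the injective linear map `toDist`;
a bounded continuous function `b` is identified with the distribution `φ ↦ ∫ b φ`. -/
structure DistributionSpace (d : ℕ) (𝓗 : Type*) [NormedAddCommGroup 𝓗] [NormedSpace ℝ 𝓗] where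
  toDist : 𝓗 →ₗ[ℝ] (𝓢(Rd d, ℝ) →L[ℝ] ℝ)
  injective : Function.Injective toDist
  contains_bcf : ∀ b : Rd d →ᵇ ℝ, ∃ h : 𝓗, ∀ φ : 𝓢(Rd d, ℝ), toDist h φ = ∫ x, b x * φ x

section Analytic

variable {d : ℕ} {𝓗 : Type*} [NormedAddCommGroup 𝓗] [NormedSpace ℝ 𝓗]

/-- The distribution `h` is (integration against) the bounded continuous function `b`. -/
def DistributionSpace.Represents (H : DistributionSpace d 𝓗) (h : 𝓗) (b : Rd d →ᵇ ℝ) : Prop :=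
  ∀ φ : 𝓢(Rd d, ℝ), H.toDist h φ = ∫ x, b x * φ x

/-- The distribution `h` is a bounded continuous function. -/
def DistributionSpace.IsBoundedContinuous (H : DistributionSpace d 𝓗) (h : 𝓗) : Prop :=
  ∃ b : Rd d →ᵇ ℝ, H.Represents h b

open Classical in
/-- The value at `x` of a distribution which is a bounded continuous function
(and `0` for the other distributions). -/
def DistributionSpace.eval (H : DistributionSpace d 𝓗) (h : 𝓗) (x : Rd d) : ℝ :=
  if hb : H.IsBoundedContinuous h then hb.choose x else 0

/-- The bounded continuous function which represents a distribution is unique. -/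
theorem DistributionSpace.Represents.unique {H : DistributionSpace d 𝓗} {h : 𝓗}
    {b b' : Rd d →ᵇ ℝ} (hb : H.Represents h b) (hb' : H.Represents h b') : b = b' := by
  have key : ∀ᵐ x ∂(volume : Measure (Rd d)), b x = b' x := by
    refine ae_eq_of_integral_contDiff_smul_eq b.continuous.locallyIntegrable
      b'.continuous.locallyIntegrable fun g hg hgc => ?_
    have h1 := (hb (hgc.toSchwartzMap hg)).symm.trans (hb' (hgc.toSchwartzMap hg))
    simpa [mul_comm] using h1
  exact DFunLike.coe_injective ((b.continuous.ae_eq_iff_eq volume b'.continuous).1 key)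

/-- `eval` gives the values of the representing function. -/
theorem DistributionSpace.Represents.eval_eq {H : DistributionSpace d 𝓗} {h : 𝓗}
    {b : Rd d →ᵇ ℝ} (hb : H.Represents h b) (x : Rd d) : H.eval h x = b x := by
  have hex : H.IsBoundedContinuous h := ⟨b, hb⟩
  rw [DistributionSpace.eval, dif_pos hex]
  rw [Represents.unique hex.choose_spec hb]

/-- For a two-parameter family `V` of bounded operators on `𝓗` (below: a propagator or the
difference of two propagators), the smallest `M ∈ [0, ∞]` with
`‖V_{s,t} h‖_∞ ≤ M ‖h‖ (t - s)^(ν / 2)` for all `h ∈ 𝓗` and `0 ≤ s < t ≤ T`. -/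
def propagatorNorm (H : DistributionSpace d 𝓗) (T : ℝ≥0) (ν : ℝ) (V : ℝ → ℝ → 𝓗 →L[ℝ] 𝓗) : ℝ≥0∞ :=
  sInf {M : ℝ≥0∞ | ∀ (h : 𝓗) (s t : ℝ), 0 ≤ s → s < t → t ≤ T → ∀ x : Rd d,
    ENNReal.ofReal |H.eval (V s t h) x| ≤ M * ‖h‖ₑ * ENNReal.ofReal ((t - s) ^ (ν / 2))}

/-- The modulus `ρ_{ν₁}(δ)` of the propagator `U`: the supremum of
`|U_{s,t} h (x) - U_{s,t} h (y)| / (t - s)^(ν₁ / 2)` over `‖h‖ ≤ 1`, `0 ≤ s < t ≤ T` and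
`|x - y| ≤ δ`. -/
def propagatorModulus (H : DistributionSpace d 𝓗) (T : ℝ≥0) (ν₁ : ℝ) (U : ℝ → ℝ → 𝓗 →L[ℝ] 𝓗)
    (δ : ℝ) : ℝ≥0∞ :=
  ⨆ (h : 𝓗) (_ : ‖h‖ ≤ 1) (s : ℝ) (t : ℝ) (_ : 0 ≤ s) (_ : s < t) (_ : t ≤ T)
    (x : Rd d) (y : Rd d) (_ : ‖x - y‖ ≤ δ),
    ENNReal.ofReal (|H.eval (U s t h) x - H.eval (U s t h) y| / (t - s) ^ (ν₁ / 2))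

end Analytic

section Stochastic

variable {d : ℕ} {𝓗 : Type*} [NormedAddCommGroup 𝓗] [NormedSpace ℝ 𝓗]
  {Ω : Type*} {mΩ : MeasurableSpace Ω}

/-- `X = (X_t)_{t ≥ 0}` is a Markov process in `ℝ^d` with respect to the filtration `𝓕`, with
Lebesgue-measurable sample paths. -/
structure IsMarkovProcess (P : Measure Ω) (𝓕 : Filtration ℝ≥0 mΩ) (X : ℝ≥0 → Ω → Rd d) : Prop where
  adapted : StronglyAdapted 𝓕 X
  markov : ∀ s t : ℝ≥0, s ≤ t → ∀ B : Set (Rd d), MeasurableSet B →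
    P[(X t ⁻¹' B).indicator (fun _ => (1 : ℝ)) | 𝓕 s]
      =ᵐ[P] P[(X t ⁻¹' B).indicator (fun _ => (1 : ℝ)) | MeasurableSpace.comap (X s) inferInstance]
  measurable_paths : ∀ ω, AEMeasurable (fun r : ℝ => X r.toNNReal ω) (volume.restrict (Set.Ici 0))

/-- The compatibility condition between the process `X`, the two-parameter family `U` of bounded
operators on `𝓗`, and the space `𝓗`, with regularity index `ν`, on the time interval `[0, T]`. -/
structure PropagatorCondition (P : Measure Ω) (𝓕 : Filtration ℝ≥0 mΩ) (H : DistributionSpace d 𝓗)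
    (T : ℝ≥0) (ν : ℝ) (X : ℝ≥0 → Ω → Rd d) (U : ℝ → ℝ → 𝓗 →L[ℝ] 𝓗) : Prop where
  isBoundedContinuous : ∀ (h : 𝓗) (s t : ℝ), 0 ≤ s → s < t → t ≤ T →
    H.IsBoundedContinuous (U s t h)
  bound : ∃ K : ℝ, 0 ≤ K ∧ ∀ (h : 𝓗) (s t : ℝ), 0 ≤ s → s < t → t ≤ T → ∀ x : Rd d,
    |H.eval (U s t h) x| ≤ K * ‖h‖ * (t - s) ^ (ν / 2)
  measurable : ∀ (s : ℝ) (x : Rd d) (h : 𝓗), 0 ≤ s →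
    AEMeasurable (fun r => H.eval (U s r h) x) (volume.restrict (Set.Icc s T))
  condExp_eq : ∀ (s r t : ℝ≥0) (h : 𝓗), s ≤ r → r < t → t ≤ T →
    P[fun ω => H.eval (U r t h) (X r ω) | 𝓕 s] =ᵐ[P] fun ω => H.eval (U s t h) (X s ω)

/-- The two-parameter process `A^X_{s,t}[f] = ∫_{[s,t]} U_{s,r} f_r (X_s) dr`. -/
def germ (H : DistributionSpace d 𝓗) (X : ℝ≥0 → Ω → Rd d) (U : ℝ → ℝ → 𝓗 →L[ℝ] 𝓗) (f : ℝ → 𝓗)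
    (s t : ℝ≥0) (ω : Ω) : ℝ :=
  ∫ r in Set.Icc (s : ℝ) t, H.eval (U s r (f r)) (X s ω)

/-- `φ` is a process obtained on `[0, T]` by (stochastic) sewing from the two-parameter process
`A`: it is adapted, `L_m`-integrable, starts from `0`, and, for some `ε > 0`, satisfies
`‖φ_t - φ_s‖_{L_m} ≲ |t - s|^(1/2 + ε)` and
`‖E[φ_t - φ_s - A_{s,t} | 𝓕_s]‖_{L_m} ≲ |t - s|^(1 + ε)`. -/
structure IsSewing (P : Measure Ω) (𝓕 : Filtration ℝ≥0 mΩ) (m : ℝ) (T : ℝ≥0)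
    (A : ℝ≥0 → ℝ≥0 → Ω → ℝ) (φ : ℝ≥0 → Ω → ℝ) : Prop where
  zero : φ 0 =ᵐ[P] 0
  adapted : ∀ t ≤ T, StronglyMeasurable[𝓕 t] (φ t)
  memLp : ∀ t ≤ T, MemLp (φ t) (ENNReal.ofReal m) P
  bounds : ∃ ε : ℝ, 0 < ε ∧ ∃ K : ℝ≥0, ∀ s t : ℝ≥0, s ≤ t → t ≤ T →
    eLpNorm (fun ω => φ t ω - φ s ω) (ENNReal.ofReal m) P
        ≤ K * ENNReal.ofReal (((t : ℝ) - s) ^ (1 / 2 + ε)) ∧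
      eLpNorm (P[fun ω => φ t ω - φ s ω - A s t ω | 𝓕 s]) (ENNReal.ofReal m) P
        ≤ K * ENNReal.ofReal (((t : ℝ) - s) ^ (1 + ε))

/-- `φ` is, up to modifications on `[0, T]`, the unique process obtained by sewing from `A`. -/
def IsUniqueSewing (P : Measure Ω) (𝓕 : Filtration ℝ≥0 mΩ) (m : ℝ) (T : ℝ≥0)
    (A : ℝ≥0 → ℝ≥0 → Ω → ℝ) (φ : ℝ≥0 → Ω → ℝ) : Prop :=
  IsSewing P 𝓕 m T A φ ∧ ∀ ψ, IsSewing P 𝓕 m T A ψ → ∀ t ≤ T, ψ t =ᵐ[P] φ t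

open Classical in
/-- The distributional functional `𝒜^X[f]`: the process obtained by sewing from `A^X[f]`
(and `0` if there is none). -/
def functional (P : Measure Ω) (𝓕 : Filtration ℝ≥0 mΩ) (m : ℝ) (T : ℝ≥0)
    (H : DistributionSpace d 𝓗) (X : ℝ≥0 → Ω → Rd d) (U : ℝ → ℝ → 𝓗 →L[ℝ] 𝓗) (f : ℝ → 𝓗) :
    ℝ≥0 → Ω → ℝ :=
  if hφ : ∃ φ, IsSewing P 𝓕 m T (germ H X U f) φ then hφ.choose else 0

/-- The distance
`D_{ν,ν₁}(X,Y) = ‖U^X - U^Y‖_{𝓗,ν} + sup_{r ∈ [0,T]} ‖ρ^X_{ν₁}(|X_r - Y_r|)‖_{L_m}`,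
with values in `[0, ∞]`. -/
def processDist (P : Measure Ω) (m : ℝ) (T : ℝ≥0) (H : DistributionSpace d 𝓗) (ν ν₁ : ℝ)
    (X Y : ℝ≥0 → Ω → Rd d) (UX UY : ℝ → ℝ → 𝓗 →L[ℝ] 𝓗) : ℝ≥0∞ :=
  propagatorNorm H T ν (UX - UY) +
    ⨆ (r : ℝ≥0) (_ : r ≤ T),
      eLpNorm (fun ω => propagatorModulus H T ν₁ UX ‖X r ω - Y r ω‖) (ENNReal.ofReal m) P

end Stochastic

end DistFunctional

end

noncomputable section

namespace DistFunctional

/-! ### A martingale inequality in `L^m`, `m ≥ 2` -/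

/-! Write `A` for the germ, `A_{s,t} = ∫ U_{s,r} f_r (X_s) dr`. By Fubini and the propagator
identity, `E[A_{u,t} | 𝓕_s] = ∫_u^t U_{s,r} f_r (X_s) dr = A_{s,t} - A_{s,u}`. Hence the defect
`A_{s,u} + A_{u,t} - A_{s,t}` has conditional mean exactly zero given `𝓕_s`, and stochastic sewing
needs only one quantitative input, a bound `‖A_{s,t}‖_{L_m} ≤ Γ (t - s)^α` with `α > 1/2`. Hölder's
inequality applied to `‖f_r‖ (r - s)^(ν/2)` provides it with `α = 1 + ν/2 - 1/q`.

Refining a partition changes the Riemann sum by a sum of defects, which are martingale differences.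
A square function inequality in `L_m`, `m ≥ 2`, turns `N` terms of size `δ^α` into `√N δ^α`, so
dyadic sums converge geometrically (`DyadicScheme.exists_limit`). The inequality is elementary:
expand `|x + y|^m` to second order, integrate, and deduce `‖X + Y‖² ≤ ‖X‖² + C ‖Y‖²` whenever `Y`
has zero conditional mean given a σ-algebra for which `X` is measurable.

Two families of partitions are used. Restricting the dyadic grid of `[0, T]` to `[s, t]` makes the
limits additive in the interval, hence increments of a process, but loses part of the exponent
(`exists_isSewing`). The dyadic grids of `[s, t]` itself give the sharp bound `C Γ (t - s)^α` for
the increments of any sewing, with `C` depending on `m` and `α` only (`IsSewing.eLpNorm_sub_le`).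
Uniqueness is the case `Γ = 0`.

For the comparison, sewing and the germ identity are linear: `𝒜^X[g] - 𝒜^Y[f]` is a sewing of the
difference of the two germs. It remains to bound that difference (`enorm_germ_sub_germ_le`), by
changing first the datum, then the point, then the propagator; the sharp increment bound does the
rest. -/

theorem exp_le_quadratic (z : ℝ) : Real.exp z ≤ 1 + z + z ^ 2 * Real.exp |z| := by
  have h := Complex.norm_exp_sub_sum_le_norm_mul_exp (z : ℂ) 2
  have h2 : ‖((Real.exp z - (1 + z) : ℝ) : ℂ)‖ ≤ |z| ^ 2 * Real.exp |z| := by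
    simpa [Finset.sum_range_succ] using h
  rw [Complex.norm_real, Real.norm_eq_abs, sq_abs] at h2
  linarith [(abs_le.1 h2).2]

/-- The constant in the second order expansion of `|x + y| ^ m`. -/
def taylorConst (m : ℝ) : ℝ := m ^ 2 * Real.exp m + 2 ^ m + m

theorem one_le_taylorConst {m : ℝ} (hm : 2 ≤ m) : 1 ≤ taylorConst m := by
  have h1 : 0 ≤ m ^ 2 * Real.exp m := by positivity
  have h2 : (0 : ℝ) ≤ 2 ^ m := by positivity
  unfold taylorConst
  linarith

theorem abs_add_rpow_le {m : ℝ} (hm : 2 ≤ m) (x y : ℝ) :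
    |x + y| ^ m ≤ |x| ^ m + m * (|x| ^ (m - 2) * x * y)
      + taylorConst m * (|x| ^ (m - 2) * y ^ 2 + |y| ^ m) := by
  have e1 : 0 ≤ m ^ 2 * Real.exp m := by positivity
  have e2 : (0 : ℝ) ≤ 2 ^ m := by positivity
  have p1 : 0 ≤ |x| ^ (m - 2) := by positivity
  have p2 : 0 ≤ |y| ^ m := by positivity
  have p3 : 0 ≤ |x| ^ m := by positivity
  have p4 : 0 ≤ |x| ^ (m - 2) * y ^ 2 := by positivity
  rcases le_or_gt |y| |x| with hyx | hyx
  · rcases eq_or_ne x 0 with rfl | hx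
    · have hy : y = 0 := by simpa using hyx
      subst hy
      simp
      rw [Real.zero_rpow (by linarith)]
      simp
    · have hx' : 0 < |x| := abs_pos.2 hx
      set u := y / x with hu
      have hyu : y = x * u := by rw [hu]; field_simp
      have hu1 : |u| ≤ 1 := by
        rw [hu, abs_div]
        exact (div_le_one hx').2 hyx
      have hu2 := abs_le.1 hu1
      have hxy : |x + y| = |x| * (1 + u) := by
        rw [hyu, show x + x * u = x * (1 + u) by ring, abs_mul, abs_of_nonneg (by linarith [hu2.1] :
          (0 : ℝ) ≤ 1 + u)]
      have hxm : |x| ^ m = |x| ^ (m - 2) * x ^ 2 := by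
        rw [← sq_abs x, ← Real.rpow_natCast |x| 2, ← Real.rpow_add hx']
        congr 1
        push_cast
        ring
      -- `1 + u ≤ exp u` reduces the power to an exponential, whose quadratic remainder is
      -- controlled because `|u m| ≤ m`; this is the origin of `m ^ 2 * Real.exp m`.
      have hpow : (1 + u) ^ m ≤ 1 + m * u + m ^ 2 * Real.exp m * u ^ 2 := by
        have h1 : (1 + u) ^ m ≤ Real.exp (u * m) := by
          rw [Real.exp_mul]
          exact Real.rpow_le_rpow (by linarith [hu2.1]) (by linarith [Real.add_one_le_exp u])
            (by linarith)
        have h2 := exp_le_quadratic (u * m)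
        have h3 : Real.exp |u * m| ≤ Real.exp m := by
          apply Real.exp_le_exp.2
          rw [abs_mul, abs_of_nonneg (by linarith : 0 ≤ m)]
          nlinarith
        have h4 : (u * m) ^ 2 * Real.exp |u * m| ≤ (u * m) ^ 2 * Real.exp m := by gcongr
        nlinarith
      rw [hxy, Real.mul_rpow hx'.le (by linarith [hu2.1])]
      calc |x| ^ m * (1 + u) ^ m
          ≤ |x| ^ m * (1 + m * u + m ^ 2 * Real.exp m * u ^ 2) := by gcongr
        _ = |x| ^ m + m * (|x| ^ (m - 2) * x * y)
              + m ^ 2 * Real.exp m * (|x| ^ (m - 2) * y ^ 2) := by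
            rw [hxm, hyu]; ring
        _ ≤ _ := by
            unfold taylorConst
            have : 0 ≤ (2 ^ m + m) * (|x| ^ (m - 2) * y ^ 2) := by positivity
            have : 0 ≤ (m ^ 2 * Real.exp m + 2 ^ m + m) * |y| ^ m := by positivity
            nlinarith
  -- When `y` dominates, every term is comparable to `|y| ^ m`. The summands `2 ^ m` and `m` of the
  -- constant pay for the left side and for a possibly negative linear term.
  · have hy0 : 0 < |y| := lt_of_le_of_lt (abs_nonneg x) hyx
    have h1 : |x + y| ^ m ≤ 2 ^ m * |y| ^ m := by
      rw [← Real.mul_rpow (by norm_num) hy0.le]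
      refine Real.rpow_le_rpow (abs_nonneg _) ?_ (by linarith)
      linarith [abs_add_le x y]
    have h2 : |(|x| ^ (m - 2) * x * y)| ≤ |y| ^ m := by
      rw [abs_mul, abs_mul, abs_of_nonneg p1]
      calc |x| ^ (m - 2) * |x| * |y| ≤ |y| ^ (m - 2) * |y| * |y| := by
            gcongr
        _ = |y| ^ m := by
            rw [mul_assoc, ← sq, ← Real.rpow_natCast |y| 2, ← Real.rpow_add hy0]
            congr 1
            push_cast
            ring
    have h3 := (abs_le.1 h2).1
    unfold taylorConst
    have : 0 ≤ (m ^ 2 * Real.exp m + 2 ^ m + m) * (|x| ^ (m - 2) * y ^ 2) := by positivity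
    have : 0 ≤ m ^ 2 * Real.exp m * |y| ^ m := by positivity
    nlinarith

/-- Replace each factor by the maximum of `x` and `y`. The choices `z = x` and `z = y` serve to
dominate the linear and the quadratic term of the expansion by integrable functions. -/
theorem rpow_sub_two_mul_mul_mul_le {m : ℝ} (hm : 2 ≤ m) (x y z : ℝ) (hx : 0 ≤ x) (hy : 0 ≤ y)
    (hz : z = x ∨ z = y) : x ^ (m - 2) * z * y ≤ x ^ m + y ^ m := by
  have key : ∀ a : ℝ, 0 ≤ a → x ≤ a → y ≤ a → x ^ (m - 2) * z * y ≤ a ^ m := by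
    intro a ha hxa hya
    have hza : z ≤ a := by rcases hz with rfl | rfl <;> assumption
    have hz0 : 0 ≤ z := by rcases hz with rfl | rfl <;> assumption
    calc x ^ (m - 2) * z * y ≤ a ^ (m - 2) * a * a := by
          gcongr
      _ = a ^ m := by
          rcases ha.eq_or_lt with rfl | ha'
          · rw [Real.zero_rpow (by linarith : m ≠ 0)]; simp
          · rw [mul_assoc, ← sq, ← Real.rpow_natCast a 2, ← Real.rpow_add ha']
            congr 1
            push_cast
            ring
  have p1 : 0 ≤ x ^ m := by positivity
  have p2 : 0 ≤ y ^ m := by positivity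
  rcases le_total x y with h | h
  · linarith [key y hy h le_rfl]
  · linarith [key x hx le_rfl h]

/-- From an expansion of `z ^ m` to a quadratic inequality. -/
theorem sq_le_of_rpow_le {m : ℝ} (hm : 2 ≤ m) {C x y z : ℝ} (hC : 1 ≤ C) (hx : 0 ≤ x) (hy : 0 ≤ y)
    (hz : 0 ≤ z) (h : z ^ m ≤ x ^ m + C * (x ^ (m - 2) * y ^ 2 + y ^ m)) :
    z ^ 2 ≤ x ^ 2 + 2 * C * y ^ 2 := by
  have hp1 : 1 ≤ m / 2 := by linarith
  have conv : ∀ a : ℝ, 0 ≤ a → a ^ m = (a ^ 2) ^ (m / 2) := by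
    intro a ha
    rw [← Real.rpow_natCast a 2, ← Real.rpow_mul ha]
    congr 1
    push_cast
    ring
  set p := m / 2 with hp
  -- With `p = m / 2 ≥ 1` the claim is a comparison of `p`-th powers of squares. One copy of `C y²`
  -- absorbs the mixed term through Bernoulli's inequality, the other absorbs `C y ^ m` through
  -- superadditivity of the power.
  have hsup : ∀ a b : ℝ, 0 ≤ a → 0 ≤ b → a ^ p + b ^ p ≤ (a + b) ^ p := fun a b ha hb =>
    Real.add_rpow_le_rpow_add ha hb hp1
  have hbern : ∀ a b : ℝ, 0 ≤ a → 0 ≤ b → a ^ p + a ^ (p - 1) * b ≤ (a + b) ^ p := by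
    intro a b ha hb
    rcases ha.eq_or_lt with rfl | ha'
    · rcases hp1.eq_or_lt with h1 | h1
      · rw [← h1]; simp
      · rw [Real.zero_rpow (by linarith), Real.zero_rpow (by linarith)]
        simp
        positivity
    · have h1 := one_add_mul_self_le_rpow_one_add (s := b / a) (by
        have : 0 ≤ b / a := by positivity
        linarith) hp1
      have h2 : (a + b) ^ p = a ^ p * (1 + b / a) ^ p := by
        rw [← Real.mul_rpow ha (by positivity)]
        congr 1
        field_simp
      rw [h2]
      have h3 : a ^ (p - 1) * b = a ^ p * (b / a) := by
        rw [Real.rpow_sub ha', Real.rpow_one]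
        field_simp
      rw [h3]
      have h4 : 0 ≤ b / a := by positivity
      have h5 : 0 ≤ a ^ p := by positivity
      calc a ^ p + a ^ p * (b / a) = a ^ p * (1 + 1 * (b / a)) := by ring
        _ ≤ a ^ p * (1 + p * (b / a)) := by gcongr
        _ ≤ _ := by gcongr
  have hx2 : x ^ (m - 2) = (x ^ 2) ^ (p - 1) := by
    rw [← Real.rpow_natCast x 2, ← Real.rpow_mul hx]
    congr 1
    push_cast
    rw [hp]
    ring
  rw [conv x hx, conv y hy, conv z hz, hx2] at h
  have hC0 : 0 ≤ C := by linarith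
  have hfin : (z ^ 2) ^ p ≤ (x ^ 2 + 2 * C * y ^ 2) ^ p := by
    have h1 := hsup (x ^ 2 + C * y ^ 2) (C * y ^ 2) (by positivity) (by positivity)
    have h2 := hbern (x ^ 2) (C * y ^ 2) (by positivity) (by positivity)
    have h3 : C * (y ^ 2) ^ p ≤ (C * y ^ 2) ^ p := by
      rw [Real.mul_rpow hC0 (by positivity)]
      gcongr
      calc C = C ^ (1 : ℝ) := (Real.rpow_one C).symm
        _ ≤ C ^ p := Real.rpow_le_rpow_of_exponent_le hC hp1
    calc (z ^ 2) ^ p ≤ _ := h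
      _ = (x ^ 2) ^ p + (x ^ 2) ^ (p - 1) * (C * y ^ 2) + C * (y ^ 2) ^ p := by ring
      _ ≤ (x ^ 2 + C * y ^ 2) ^ p + (C * y ^ 2) ^ p := by linarith
      _ ≤ (x ^ 2 + C * y ^ 2 + C * y ^ 2) ^ p := h1
      _ = _ := by congr 1; ring
  exact (Real.rpow_le_rpow_iff (by positivity) (by positivity) (by linarith)).1 hfin

/-! ### Integrated expansion and the square function inequality -/

section Martingale

variable {Ω : Type*} {mΩ : MeasurableSpace Ω} {P : Measure Ω}

theorem integrable_abs_rpow {m : ℝ} (hm : 2 ≤ m) {X : Ω → ℝ}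
    (hX : MemLp X (ENNReal.ofReal m) P) : Integrable (fun ω => |X ω| ^ m) P := by
  have h := hX.integrable_norm_rpow (by simp; linarith) (by simp)
  rw [ENNReal.toReal_ofReal (by linarith)] at h
  simpa using! h

theorem toReal_eLpNorm_rpow {m : ℝ} (hm : 2 ≤ m) {X : Ω → ℝ}
    (hX : MemLp X (ENNReal.ofReal m) P) :
    (eLpNorm X (ENNReal.ofReal m) P).toReal ^ m = ∫ ω, |X ω| ^ m ∂P := by
  have hI : 0 ≤ ∫ ω, |X ω| ^ m ∂P := integral_nonneg fun ω => by positivity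
  have h := hX.eLpNorm_eq_integral_rpow_norm (by simp; linarith) (by simp)
  rw [ENNReal.toReal_ofReal (by linarith)] at h
  simp only [Real.norm_eq_abs] at h
  rw [h, ENNReal.toReal_ofReal (by positivity), ← Real.rpow_mul hI,
    inv_mul_cancel₀ (by linarith), Real.rpow_one]

/-- Hölder's inequality with weights `(m - 2) / m` and `2 / m`; the weighted form also covers `m =
2`, where the first weight is zero. -/
theorem integral_rpow_sub_two_mul_sq_le {m : ℝ} (hm : 2 ≤ m) {X Y : Ω → ℝ}
    (hX : MemLp X (ENNReal.ofReal m) P) (hY : MemLp Y (ENNReal.ofReal m) P) :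
    ∫ ω, |X ω| ^ (m - 2) * Y ω ^ 2 ∂P ≤
      (eLpNorm X (ENNReal.ofReal m) P).toReal ^ (m - 2)
        * (eLpNorm Y (ENNReal.ofReal m) P).toReal ^ 2 := by
  have hm0 : 0 < m := by linarith
  have hA := hX.aestronglyMeasurable.aemeasurable
  have hB := hY.aestronglyMeasurable.aemeasurable
  have key := ENNReal.lintegral_mul_norm_pow_le (μ := P) (f := fun ω => ‖X ω‖ₑ ^ m)
    (g := fun ω => ‖Y ω‖ₑ ^ m) (by fun_prop) (by fun_prop) (p := (m - 2) / m) (q := 2 / m)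
    (div_nonneg (by linarith) hm0.le) (by positivity) (by field_simp; ring)
  have e : ∀ Z : Ω → ℝ, ∀ r : ℝ, (∫⁻ ω, ‖Z ω‖ₑ ^ m ∂P) ^ (r / m)
      = eLpNorm Z (ENNReal.ofReal m) P ^ r := by
    intro Z r
    rw [eLpNorm_eq_lintegral_rpow_enorm_toReal (by simp; linarith) (by simp),
      ENNReal.toReal_ofReal hm0.le, ← ENNReal.rpow_mul]
    congr 1
    field_simp
  rw [e, e] at key
  have hpt : ∀ ω, (‖X ω‖ₑ ^ m) ^ ((m - 2) / m) * (‖Y ω‖ₑ ^ m) ^ (2 / m)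
      = ENNReal.ofReal (|X ω| ^ (m - 2) * Y ω ^ 2) := by
    intro ω
    rw [← ENNReal.rpow_mul, ← ENNReal.rpow_mul, mul_div_cancel₀ _ hm0.ne',
      mul_div_cancel₀ _ hm0.ne', ENNReal.ofReal_mul (by positivity),
      ← ENNReal.ofReal_rpow_of_nonneg (abs_nonneg _) (by linarith), ← sq_abs (Y ω),
      ← Real.rpow_natCast, ← ENNReal.ofReal_rpow_of_nonneg (abs_nonneg _) (by norm_num),
      Real.enorm_eq_ofReal_abs, Real.enorm_eq_ofReal_abs]
    norm_num
  simp_rw [hpt] at key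
  rw [integral_eq_lintegral_of_nonneg_ae (Eventually.of_forall fun ω => by positivity) (by fun_prop)]
  refine (ENNReal.toReal_mono ?_ key).trans_eq ?_
  · exact ENNReal.mul_ne_top (ENNReal.rpow_ne_top_of_nonneg (by linarith) hX.eLpNorm_ne_top)
      (ENNReal.rpow_ne_top_of_nonneg (by norm_num) hY.eLpNorm_ne_top)
  · rw [ENNReal.toReal_mul, ← ENNReal.toReal_rpow, ← ENNReal.toReal_rpow]
    norm_num

/-- In the integrated expansion the linear term vanishes, since `|X| ^ (m - 2) * X` is
`G`-measurable and `Y` has zero conditional mean. What remains is an inequality between the norms,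
which `sq_le_of_rpow_le` makes quadratic. -/
theorem eLpNorm_add_sq_le [IsProbabilityMeasure P] {m : ℝ} (hm : 2 ≤ m) {X Y : Ω → ℝ}
    {G : MeasurableSpace Ω} (hG : G ≤ mΩ) (hXG : StronglyMeasurable[G] X)
    (hX : MemLp X (ENNReal.ofReal m) P) (hY : MemLp Y (ENNReal.ofReal m) P)
    (hYG : P[Y | G] =ᵐ[P] 0) :
    (eLpNorm (X + Y) (ENNReal.ofReal m) P).toReal ^ 2 ≤
      (eLpNorm X (ENNReal.ofReal m) P).toReal ^ 2
        + 2 * taylorConst m * (eLpNorm Y (ENNReal.ofReal m) P).toReal ^ 2 := by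
  have hm0 : 0 < m := by linarith
  have hone : 1 ≤ ENNReal.ofReal m := by simp; linarith
  have iX := integrable_abs_rpow hm hX
  have iY := integrable_abs_rpow hm hY
  have mX := hX.aestronglyMeasurable
  have mY := hY.aestronglyMeasurable
  have aX := mX.aemeasurable
  have aY := mY.aemeasurable
  have i1 : Integrable (fun ω => |X ω| ^ (m - 2) * X ω * Y ω) P := by
    refine (iX.add iY).mono' (by fun_prop) (Eventually.of_forall fun ω => ?_)
    have := rpow_sub_two_mul_mul_mul_le hm |X ω| |Y ω| |X ω| (abs_nonneg _) (abs_nonneg _)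
      (Or.inl rfl)
    simpa [abs_mul, abs_of_nonneg (Real.rpow_nonneg (abs_nonneg (X ω)) _)] using this
  have i2 : Integrable (fun ω => |X ω| ^ (m - 2) * Y ω ^ 2) P := by
    refine (iX.add iY).mono' (by fun_prop) (Eventually.of_forall fun ω => ?_)
    have := rpow_sub_two_mul_mul_mul_le hm |X ω| |Y ω| |Y ω| (abs_nonneg _) (abs_nonneg _)
      (Or.inr rfl)
    rw [Real.norm_eq_abs, abs_of_nonneg (by positivity), ← sq_abs (Y ω), sq, ← mul_assoc]
    exact this
  have hzero : ∫ ω, |X ω| ^ (m - 2) * X ω * Y ω ∂P = 0 := by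
    have hs : StronglyMeasurable[G] fun ω => |X ω| ^ (m - 2) * X ω := by
      have : Measurable[G] X := hXG.measurable
      exact Measurable.stronglyMeasurable (by fun_prop)
    have h1 := condExp_mul_of_stronglyMeasurable_left (μ := P) hs i1 (hY.integrable hone)
    rw [← integral_condExp hG]
    have h2 : P[(fun ω => |X ω| ^ (m - 2) * X ω) * Y | G] =ᵐ[P] 0 := by
      filter_upwards [h1, hYG] with ω h1 h2
      rw [h1]
      simp [h2]
    exact integral_eq_zero_of_ae h2
  refine sq_le_of_rpow_le hm (one_le_taylorConst hm) ENNReal.toReal_nonneg ENNReal.toReal_nonneg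
    ENNReal.toReal_nonneg ?_
  rw [toReal_eLpNorm_rpow hm (hX.add hY), toReal_eLpNorm_rpow hm hX, toReal_eLpNorm_rpow hm hY]
  have hC : 0 ≤ taylorConst m := zero_le_one.trans (one_le_taylorConst hm)
  have j1 : Integrable (fun ω => |X ω| ^ m + m * (|X ω| ^ (m - 2) * X ω * Y ω)) P :=
    iX.add (i1.const_mul _)
  have j2 : Integrable
      (fun ω => taylorConst m * (|X ω| ^ (m - 2) * Y ω ^ 2 + |Y ω| ^ m)) P :=
    (i2.add iY).const_mul _
  calc ∫ ω, |(X + Y) ω| ^ m ∂P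
      ≤ ∫ ω, (|X ω| ^ m + m * (|X ω| ^ (m - 2) * X ω * Y ω)
          + taylorConst m * (|X ω| ^ (m - 2) * Y ω ^ 2 + |Y ω| ^ m)) ∂P :=
        integral_mono (integrable_abs_rpow hm (hX.add hY))
          (j1.add j2)
          fun ω => abs_add_rpow_le hm _ _
    _ = ∫ ω, |X ω| ^ m ∂P
          + taylorConst m * (∫ ω, |X ω| ^ (m - 2) * Y ω ^ 2 ∂P + ∫ ω, |Y ω| ^ m ∂P) := by
        rw [integral_add j1 j2, integral_add iX (i1.const_mul _), integral_const_mul,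
          integral_const_mul,
          integral_add i2 iY, hzero]
        ring
    _ ≤ _ := by
        gcongr
        exact integral_rpow_sub_two_mul_sq_le hm hX hY

/-- The square function inequality for sums of martingale differences in `L^m`, `m ≥ 2`. -/
theorem eLpNorm_sum_sq_le [IsProbabilityMeasure P] {m : ℝ} (hm : 2 ≤ m) {D : ℕ → Ω → ℝ}
    {G : ℕ → MeasurableSpace Ω} (hG : ∀ i, G i ≤ mΩ) (hmono : Monotone G) {N : ℕ}
    (hD : ∀ i < N, StronglyMeasurable[G (i + 1)] (D i))
    (hL : ∀ i < N, MemLp (D i) (ENNReal.ofReal m) P) (h0 : ∀ i < N, P[D i | G i] =ᵐ[P] 0) :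
    (eLpNorm (∑ i ∈ Finset.range N, D i) (ENNReal.ofReal m) P).toReal ^ 2 ≤
      2 * taylorConst m * ∑ i ∈ Finset.range N, (eLpNorm (D i) (ENNReal.ofReal m) P).toReal ^ 2 := by
  induction N with
  | zero => simp
  | succ n ih =>
    have ih' := ih (fun i hi => hD i (by omega)) (fun i hi => hL i (by omega))
      (fun i hi => h0 i (by omega))
    rw [Finset.sum_range_succ, Finset.sum_range_succ, mul_add]
    refine (eLpNorm_add_sq_le hm (hG n) ?_ ?_ (hL n (by omega)) (h0 n (by omega))).trans
      (by linarith)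
    · refine Finset.stronglyMeasurable_sum _ fun i hi => ?_
      have hi' := Finset.mem_range.1 hi
      exact (hD i (by omega)).mono (hmono (by omega))
    · exact memLp_finsetSum' _ fun i hi => hL i (by have := Finset.mem_range.1 hi; omega)

theorem eLpNorm_sum_le_of_martingaleDifference [IsProbabilityMeasure P] {m : ℝ} (hm : 2 ≤ m)
    {D : ℕ → Ω → ℝ} {G : ℕ → MeasurableSpace Ω} (hG : ∀ i, G i ≤ mΩ) (hmono : Monotone G) {N : ℕ}
    (hD : ∀ i < N, StronglyMeasurable[G (i + 1)] (D i))
    (hL : ∀ i < N, MemLp (D i) (ENNReal.ofReal m) P) (h0 : ∀ i < N, P[D i | G i] =ᵐ[P] 0)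
    {Γ : ℝ≥0} {b : ℕ → ℝ} (hb0 : ∀ i < N, 0 ≤ b i)
    (hb : ∀ i < N, eLpNorm (D i) (ENNReal.ofReal m) P ≤ Γ * ENNReal.ofReal (b i))
    {B : ℝ} (hB0 : 0 ≤ B) (hB : ∑ i ∈ Finset.range N, b i ^ 2 ≤ B ^ 2) :
    eLpNorm (∑ i ∈ Finset.range N, D i) (ENNReal.ofReal m) P
      ≤ ENNReal.ofReal (2 * taylorConst m) * Γ * ENNReal.ofReal B := by
  have hC := one_le_taylorConst hm
  have hmem : MemLp (∑ i ∈ Finset.range N, D i) (ENNReal.ofReal m) P :=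
    memLp_finsetSum' _ fun i hi => hL i (Finset.mem_range.1 hi)
  have h1 := eLpNorm_sum_sq_le hm hG hmono hD hL h0
  have h2 : ∀ i ∈ Finset.range N, (eLpNorm (D i) (ENNReal.ofReal m) P).toReal ^ 2
      ≤ (Γ : ℝ) ^ 2 * b i ^ 2 := by
    intro i hi
    have hi' := Finset.mem_range.1 hi
    have h3 : (eLpNorm (D i) (ENNReal.ofReal m) P).toReal ≤ Γ * b i := by
      have := ENNReal.toReal_mono (by finiteness) (hb i hi')
      rwa [ENNReal.toReal_mul, ENNReal.toReal_ofReal (hb0 i hi'), ENNReal.coe_toReal] at this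
    rw [← mul_pow]
    exact pow_le_pow_left₀ ENNReal.toReal_nonneg h3 2
  have h3 := Finset.sum_le_sum h2
  rw [← Finset.mul_sum] at h3
  have h4 : (eLpNorm (∑ i ∈ Finset.range N, D i) (ENNReal.ofReal m) P).toReal ^ 2
      ≤ (2 * taylorConst m * Γ * B) ^ 2 := by
    calc _ ≤ _ := h1
      _ ≤ 2 * taylorConst m * ((Γ : ℝ) ^ 2 * B ^ 2) := by
          gcongr
          exact h3.trans (by gcongr)
      -- The constant is at least one, so squaring it is harmless and avoids a square root in the
      -- result.
      _ ≤ (2 * taylorConst m) ^ 2 * ((Γ : ℝ) ^ 2 * B ^ 2) := by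
          gcongr
          nlinarith
      _ = _ := by ring
  have h5 := (pow_le_pow_iff_left₀ ENNReal.toReal_nonneg (by positivity) two_ne_zero).1 h4
  rw [← ENNReal.ofReal_toReal hmem.eLpNorm_ne_top]
  refine (ENNReal.ofReal_le_ofReal h5).trans_eq ?_
  rw [ENNReal.ofReal_mul (by positivity), ENNReal.ofReal_mul (by positivity),
    ENNReal.ofReal_coe_nnreal]

end Martingale

/-! ### Stochastic sewing for germs whose defect is a martingale difference -/

section Sewing

variable {Ω : Type*} {mΩ : MeasurableSpace Ω} {P : Measure Ω} {𝓕 : Filtration ℝ≥0 mΩ}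
  {m : ℝ} {T : ℝ≥0} {A : ℝ≥0 → ℝ≥0 → Ω → ℝ}

/-- A two-parameter process `A` with `E[A_{u,t} | 𝓕_s] = A_{s,t} - A_{s,u}`. -/
structure IsGerm (P : Measure Ω) (𝓕 : Filtration ℝ≥0 mΩ) (m : ℝ) (T : ℝ≥0)
    (A : ℝ≥0 → ℝ≥0 → Ω → ℝ) : Prop where
  stronglyMeasurable : ∀ s t : ℝ≥0, s ≤ t → t ≤ T → StronglyMeasurable[𝓕 s] (A s t)
  memLp : ∀ s t : ℝ≥0, s ≤ t → t ≤ T → MemLp (A s t) (ENNReal.ofReal m) P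
  condExp_eq : ∀ s u t : ℝ≥0, s ≤ u → u ≤ t → t ≤ T →
    P[A u t | 𝓕 s] =ᵐ[P] A s t - A s u

/-- The additivity defect of a two-parameter process. -/
def defect (A : ℝ≥0 → ℝ≥0 → Ω → ℝ) (a u b : ℝ≥0) : Ω → ℝ := A a u + A u b - A a b

/-- The `L^m` bound `‖A_{s,t}‖ ≤ Γ (t - s) ^ α`. -/
def GermBound (P : Measure Ω) (m : ℝ) (T : ℝ≥0) (A : ℝ≥0 → ℝ≥0 → Ω → ℝ) (Γ : ℝ≥0) (α : ℝ) : Prop :=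
  ∀ s t : ℝ≥0, s ≤ t → t ≤ T →
    eLpNorm (A s t) (ENNReal.ofReal m) P ≤ Γ * ENNReal.ofReal (((t : ℝ) - s) ^ α)

theorem one_le_ofReal (hm : 2 ≤ m) : 1 ≤ ENNReal.ofReal m := by
  rw [ENNReal.one_le_ofReal]
  linarith

/-- Each term is known at its left endpoint, and `u` is the latest of these. Together with
`IsGerm.condExp_defect` this makes defects along a partition martingale differences. -/
theorem IsGerm.stronglyMeasurable_defect (hA : IsGerm P 𝓕 m T A) {a u b : ℝ≥0} (hau : a ≤ u)
    (hub : u ≤ b) (hb : b ≤ T) : StronglyMeasurable[𝓕 u] (defect A a u b) :=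
  (((hA.stronglyMeasurable a u hau (hub.trans hb)).mono (𝓕.mono hau)).add
    (hA.stronglyMeasurable u b hub hb)).sub
      ((hA.stronglyMeasurable a b (hau.trans hub) hb).mono (𝓕.mono hau))

theorem IsGerm.memLp_defect (hA : IsGerm P 𝓕 m T A) {a u b : ℝ≥0} (hau : a ≤ u)
    (hub : u ≤ b) (hb : b ≤ T) : MemLp (defect A a u b) (ENNReal.ofReal m) P :=
  ((hA.memLp a u hau (hub.trans hb)).add (hA.memLp u b hub hb)).sub
    (hA.memLp a b (hau.trans hub) hb)

theorem eLpNorm_defect_le (hm : 2 ≤ m) (hA : IsGerm P 𝓕 m T A) {Γ : ℝ≥0} {α : ℝ} (hα : 1 / 2 < α)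
    (hb : GermBound P m T A Γ α) {a u b : ℝ≥0} (hau : a ≤ u) (hub : u ≤ b) (hbT : b ≤ T) :
    eLpNorm (defect A a u b) (ENNReal.ofReal m) P
      ≤ (3 * Γ : ℝ≥0) * ENNReal.ofReal (((b : ℝ) - a) ^ α) := by
  have hau' : (a : ℝ) ≤ u := hau
  have hub' : (u : ℝ) ≤ b := hub
  have m1 := hA.memLp a u hau (hub.trans hbT)
  have m2 := hA.memLp u b hub hbT
  have m3 := hA.memLp a b (hau.trans hub) hbT
  have h1 := hb a u hau (hub.trans hbT)
  have h2 := hb u b hub hbT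
  have h3 := hb a b (hau.trans hub) hbT
  have h1' : ENNReal.ofReal (((u : ℝ) - a) ^ α) ≤ ENNReal.ofReal (((b : ℝ) - a) ^ α) :=
    ENNReal.ofReal_le_ofReal (Real.rpow_le_rpow (by linarith) (by linarith) (by linarith))
  have h2' : ENNReal.ofReal (((b : ℝ) - u) ^ α) ≤ ENNReal.ofReal (((b : ℝ) - a) ^ α) :=
    ENNReal.ofReal_le_ofReal (Real.rpow_le_rpow (by linarith) (by linarith) (by linarith))
  calc eLpNorm (defect A a u b) (ENNReal.ofReal m) P
      ≤ eLpNorm (A a u + A u b) (ENNReal.ofReal m) P + eLpNorm (A a b) (ENNReal.ofReal m) P :=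
        eLpNorm_sub_le (m1.add m2).1 m3.1 (one_le_ofReal hm)
    _ ≤ eLpNorm (A a u) (ENNReal.ofReal m) P + eLpNorm (A u b) (ENNReal.ofReal m) P
          + eLpNorm (A a b) (ENNReal.ofReal m) P := by
        gcongr
        exact eLpNorm_add_le m1.1 m2.1 (one_le_ofReal hm)
    _ ≤ Γ * ENNReal.ofReal (((b : ℝ) - a) ^ α) + Γ * ENNReal.ofReal (((b : ℝ) - a) ^ α)
          + Γ * ENNReal.ofReal (((b : ℝ) - a) ^ α) := by
        gcongr
        · exact h1.trans (by gcongr)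
        · exact h2.trans (by gcongr)
    _ = _ := by push_cast; ring

/-- The sum of a two-parameter process along a partition. -/
def partitionSum (A : ℝ≥0 → ℝ≥0 → Ω → ℝ) (a : ℕ → ℝ≥0) (N : ℕ) : Ω → ℝ :=
  ∑ i ∈ Finset.range N, A (a i) (a (i + 1))

theorem IsGerm.memLp_partitionSum (hA : IsGerm P 𝓕 m T A) {a : ℕ → ℝ≥0} {N : ℕ} (ha : Monotone a)
    (haT : a N ≤ T) : MemLp (partitionSum A a N) (ENNReal.ofReal m) P :=
  memLp_finsetSum' _ fun i hi => hA.memLp _ _ (ha (Nat.le_succ i))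
    ((ha (Finset.mem_range.1 hi)).trans haT)

variable [IsProbabilityMeasure P]

theorem IsGerm.integrable (hm : 2 ≤ m) (hA : IsGerm P 𝓕 m T A) {s t : ℝ≥0} (hst : s ≤ t)
    (ht : t ≤ T) : Integrable (A s t) P :=
  (hA.memLp s t hst ht).integrable (one_le_ofReal hm)

/-- Take all three times equal in the conditional identity: `A s s = A s s - A s s`. -/
theorem IsGerm.self_eq_zero (hm : 2 ≤ m) (hA : IsGerm P 𝓕 m T A) {s : ℝ≥0} (hs : s ≤ T) :
    A s s =ᵐ[P] 0 := by
  have h := hA.condExp_eq s s s le_rfl le_rfl hs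
  rw [condExp_of_stronglyMeasurable (𝓕.le s) (hA.stronglyMeasurable s s le_rfl hs)
    (hA.integrable hm le_rfl hs), sub_self] at h
  exact h

theorem IsGerm.condExp_defect (hm : 2 ≤ m) (hA : IsGerm P 𝓕 m T A) {a u b : ℝ≥0} (hau : a ≤ u)
    (hub : u ≤ b) (hb : b ≤ T) : P[defect A a u b | 𝓕 a] =ᵐ[P] 0 := by
  have i1 := hA.integrable hm hau (hub.trans hb)
  have i2 := hA.integrable hm hub hb
  have i3 := hA.integrable hm (hau.trans hub) hb
  have h1 := condExp_sub (i1.add i2) i3 (𝓕 a)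
  have h2 := condExp_add i1 i2 (𝓕 a)
  have h3 := hA.condExp_eq a u b hau hub hb
  have e1 := condExp_of_stronglyMeasurable (𝓕.le a)
    (hA.stronglyMeasurable a u hau (hub.trans hb)) i1
  have e3 := condExp_of_stronglyMeasurable (𝓕.le a)
    (hA.stronglyMeasurable a b (hau.trans hub) hb) i3
  filter_upwards [h1, h2, h3] with ω h1 h2 h3
  have : P[defect A a u b | 𝓕 a] ω = P[A a u + A u b - A a b | 𝓕 a] ω := rfl
  rw [this, h1, Pi.sub_apply, h2, Pi.add_apply, h3, e1, e3]
  simp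

/-- The sum of the defects along a partition of mesh at most `h`. -/
theorem eLpNorm_sum_defect_le (hm : 2 ≤ m) (hA : IsGerm P 𝓕 m T A) {Γ : ℝ≥0} {α : ℝ}
    (hα : 1 / 2 < α) (hb : GermBound P m T A Γ α) {a u : ℕ → ℝ≥0} {N : ℕ} (ha : Monotone a)
    (hau : ∀ i, a i ≤ u i) (hua : ∀ i, u i ≤ a (i + 1)) (haT : a N ≤ T) {h : ℝ} (hh : 0 ≤ h)
    (hmesh : ∀ i < N, (a (i + 1) : ℝ) - a i ≤ h) :
    eLpNorm (∑ i ∈ Finset.range N, defect A (a i) (u i) (a (i + 1))) (ENNReal.ofReal m) P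
      ≤ ENNReal.ofReal (2 * taylorConst m) * (3 * Γ : ℝ≥0)
        * ENNReal.ofReal (h ^ (α - 1 / 2) * ((a N : ℝ) - a 0) ^ (1 / 2 : ℝ)) := by
  have hinc : ∀ i, 0 ≤ (a (i + 1) : ℝ) - a i := fun i => sub_nonneg.2 (ha (Nat.le_succ i))
  have hT : ∀ i < N, a (i + 1) ≤ T := fun i hi => (ha (by omega)).trans haT
  have htot : 0 ≤ (a N : ℝ) - a 0 := sub_nonneg.2 (ha (Nat.zero_le _))
  refine eLpNorm_sum_le_of_martingaleDifference hm (G := fun i => 𝓕 (a i)) (fun i => 𝓕.le _)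
    (fun i j hij => 𝓕.mono (ha hij)) (b := fun i => ((a (i + 1) : ℝ) - a i) ^ α)
    (fun i hi => (hA.stronglyMeasurable_defect (hau i) (hua i) (hT i hi)).mono (𝓕.mono (hua i)))
    (fun i hi => hA.memLp_defect (hau i) (hua i) (hT i hi))
    (fun i hi => hA.condExp_defect hm (hau i) (hua i) (hT i hi))
    (fun i hi => Real.rpow_nonneg (hinc i) _)
    (fun i hi => eLpNorm_defect_le hm hA hα hb (hau i) (hua i) (hT i hi)) (by positivity) ?_
  -- Split `x ^ α = x ^ (α - 1/2) * x ^ (1/2)`: the mesh bounds the first factor, and the squares of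
  -- the second telescope to the length of the interval.
  have h1 : ∀ x : ℝ, 0 ≤ x → x ≤ h → (x ^ α) ^ 2 ≤ (h ^ (α - 1 / 2)) ^ 2 * x := by
    intro x hx hxh
    rcases hx.eq_or_lt with rfl | hx'
    · rw [Real.zero_rpow (by linarith)]; simp
    · have : x ^ α = x ^ (α - 1 / 2) * x ^ (1 / 2 : ℝ) := by
        rw [← Real.rpow_add hx']; congr 1; ring
      rw [this, mul_pow, ← Real.sqrt_eq_rpow, Real.sq_sqrt hx]
      gcongr
  calc ∑ i ∈ Finset.range N, (((a (i + 1) : ℝ) - a i) ^ α) ^ 2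
      ≤ ∑ i ∈ Finset.range N, (h ^ (α - 1 / 2)) ^ 2 * ((a (i + 1) : ℝ) - a i) :=
        Finset.sum_le_sum fun i hi => h1 _ (hinc i) (hmesh i (Finset.mem_range.1 hi))
    _ = (h ^ (α - 1 / 2)) ^ 2 * ((a N : ℝ) - a 0) := by
        rw [← Finset.mul_sum, Finset.sum_range_sub (fun i => (a i : ℝ))]
    _ = _ := by rw [mul_pow, ← Real.sqrt_eq_rpow, Real.sq_sqrt htot]

end Sewing

/-! ### Limits in `L^p`: completeness, uniqueness, conditional expectations -/

section Limits

variable {Ω : Type*} {mΩ : MeasurableSpace Ω} {P : Measure Ω}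

theorem exists_limit_of_geometric {p : ℝ≥0∞} (hp : 1 ≤ p) {S : ℕ → Ω → ℝ}
    (hS : ∀ n, MemLp (S n) p P) {C r : ℝ≥0∞} (hC : C ≠ ∞) (hr : r < 1)
    (h : ∀ n, eLpNorm (S (n + 1) - S n) p P ≤ C * r ^ n) :
    ∃ L : Ω → ℝ, MemLp L p P ∧ Tendsto (fun n => eLpNorm (S n - L) p P) atTop (𝓝 0) ∧
      eLpNorm (L - S 0) p P ≤ C / (1 - r) := by
  have : Fact (1 ≤ p) := ⟨hp⟩
  set F : ℕ → Lp ℝ p P := fun n => (hS n).toLp (S n) with hF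
  have hd : ∀ n, edist (F n) (F (n + 1)) ≤ C * r ^ n := by
    intro n
    rw [edist_comm, hF, Lp.edist_toLp_toLp]
    exact h n
  obtain ⟨L, hL⟩ := cauchySeq_tendsto_of_complete (cauchySeq_of_edist_le_geometric r C hr hC hd)
  have hLL : ∀ n, edist (F n) L = eLpNorm (S n - (L : Ω → ℝ)) p P := by
    intro n
    rw [← Lp.edist_toLp_toLp (S n) L (hS n) (Lp.memLp L), Lp.toLp_coeFn]
  refine ⟨L, Lp.memLp L, ?_, ?_⟩
  · have := tendsto_iff_edist_tendsto_0.1 hL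
    simpa only [hLL] using this
  · have := edist_le_of_edist_le_geometric_of_tendsto₀ r C hd hL
    rw [hLL] at this
    rwa [eLpNorm_sub_comm]

theorem eLpNorm_sub_eq_zero_of_tendsto {p : ℝ≥0∞} (hp : 1 ≤ p) {S : ℕ → Ω → ℝ} {L L' : Ω → ℝ}
    (hS : ∀ n, AEStronglyMeasurable (S n) P) (hL : AEStronglyMeasurable L P)
    (hL' : AEStronglyMeasurable L' P) (h : Tendsto (fun n => eLpNorm (S n - L) p P) atTop (𝓝 0))
    (h' : Tendsto (fun n => eLpNorm (S n - L') p P) atTop (𝓝 0)) : L =ᵐ[P] L' := by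
  have hsum := h.add h'
  rw [add_zero] at hsum
  have h0 : eLpNorm (L - L') p P = 0 := by
    refine le_antisymm (ge_of_tendsto' hsum fun n => ?_) bot_le
    have : L - L' = (S n - L') - (S n - L) := by abel
    rw [this, add_comm]
    exact eLpNorm_sub_le ((hS n).sub hL') ((hS n).sub hL) hp
  have := (eLpNorm_eq_zero_iff (hL.sub hL') (by positivity)).1 h0
  filter_upwards [this] with ω hω
  exact sub_eq_zero.1 hω

theorem tendsto_eLpNorm_condExp {p : ℝ≥0∞} (hp : 1 ≤ p) [IsFiniteMeasure P] {S : ℕ → Ω → ℝ}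
    {L : Ω → ℝ} (hS : ∀ n, MemLp (S n) p P) (hL : MemLp L p P) (G : MeasurableSpace Ω)
    (h : Tendsto (fun n => eLpNorm (S n - L) p P) atTop (𝓝 0)) :
    Tendsto (fun n => eLpNorm (P[S n | G] - P[L | G]) p P) atTop (𝓝 0) := by
  refine tendsto_of_tendsto_of_tendsto_of_le_of_le tendsto_const_nhds h (fun _ => bot_le)
    fun n => ?_
  dsimp only
  rw [← eLpNorm_congr_ae (condExp_sub ((hS n).integrable hp) (hL.integrable hp) G)]
  exact eLpNorm_condExp_le_eLpNorm _ hp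

end Limits

/-- A nested sequence of partitions of `[s, t]` with `2 ^ n` intervals, of mesh at most
`h * r ^ n`. -/
structure DyadicScheme (s t : ℝ≥0) (c : ℕ → ℕ → ℝ≥0) (h r : ℝ) : Prop where
  mono : ∀ n, Monotone (c n)
  left : ∀ n, c n 0 = s
  right : ∀ n, c n (2 ^ n) = t
  nested : ∀ n i, c (n + 1) (2 * i) = c n i
  mesh : ∀ n i, (c n (i + 1) : ℝ) - c n i ≤ h * r ^ n

/-- The dyadic partitions of `[s, s + τ]`. -/
def dyadicGrid (s τ : ℝ≥0) (n i : ℕ) : ℝ≥0 := s + i * τ / 2 ^ n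

theorem dyadicGrid_mono (s τ : ℝ≥0) (n : ℕ) : Monotone (dyadicGrid s τ n) := by
  intro i j hij
  unfold dyadicGrid
  gcongr

theorem dyadicGrid_nested (s τ : ℝ≥0) (n i : ℕ) :
    dyadicGrid s τ (n + 1) (2 * i) = dyadicGrid s τ n i := by
  unfold dyadicGrid
  push_cast
  congr 1
  field_simp
  ring

theorem dyadicGrid_succ_sub (s τ : ℝ≥0) (n i : ℕ) :
    (dyadicGrid s τ n (i + 1) : ℝ) - dyadicGrid s τ n i = τ * (1 / 2) ^ n := by
  unfold dyadicGrid
  push_cast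
  rw [div_pow]
  field_simp
  ring

theorem dyadicScheme_grid {s t : ℝ≥0} (hst : s ≤ t) :
    DyadicScheme s t (dyadicGrid s (t - s)) ((t : ℝ) - s) (1 / 2) where
  mono := dyadicGrid_mono _ _
  left n := by simp [dyadicGrid]
  right n := by
    unfold dyadicGrid
    push_cast
    rw [mul_div_cancel_left₀ _ (by positivity)]
    exact add_tsub_cancel_of_le hst
  nested := dyadicGrid_nested _ _
  mesh n i := by
    rw [dyadicGrid_succ_sub, NNReal.coe_sub hst]

/-- The dyadic partitions of `[0, T]`, restricted to `[s, t]`. -/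
def clampedGrid (T s t : ℝ≥0) (n i : ℕ) : ℝ≥0 := max s (min (dyadicGrid 0 T n i) t)

/-- Truncation to an interval is 1-Lipschitz, so the mesh of the global grid is not increased. -/
theorem clampedGrid_succ_sub_le (T s t : ℝ≥0) (n i : ℕ) :
    (clampedGrid T s t n (i + 1) : ℝ) - clampedGrid T s t n i ≤ T * (1 / 2) ^ n := by
  have h := dyadicGrid_succ_sub 0 T n i
  have h0 : (0 : ℝ) ≤ T * (1 / 2) ^ n := by positivity
  unfold clampedGrid
  push_cast
  generalize (dyadicGrid 0 T n (i + 1) : ℝ) = y at *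
  generalize (dyadicGrid 0 T n i : ℝ) = x at *
  rcases max_cases (s : ℝ) (min y t) with ⟨h1, h2⟩ | ⟨h1, h2⟩ <;>
  rcases max_cases (s : ℝ) (min x t) with ⟨h3, h4⟩ | ⟨h3, h4⟩ <;>
  rcases min_cases y (t : ℝ) with ⟨h5, h6⟩ | ⟨h5, h6⟩ <;>
  rcases min_cases x (t : ℝ) with ⟨h7, h8⟩ | ⟨h7, h8⟩ <;> linarith

theorem clampedGrid_mem {T s t : ℝ≥0} (hst : s ≤ t) (n i : ℕ) :
    s ≤ clampedGrid T s t n i ∧ clampedGrid T s t n i ≤ t :=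
  ⟨le_max_left _ _, max_le hst (min_le_right _ _)⟩

theorem clampedGrid_mono (T s t : ℝ≥0) (n : ℕ) : Monotone (clampedGrid T s t n) := fun _ _ hij =>
  max_le_max le_rfl (min_le_min (dyadicGrid_mono _ _ _ hij) le_rfl)

theorem clampedGrid_right {T s t : ℝ≥0} (hst : s ≤ t) (ht : t ≤ T) (n : ℕ) :
    clampedGrid T s t n (2 ^ n) = t := by
  have : dyadicGrid 0 T n (2 ^ n) = T := by
    unfold dyadicGrid
    push_cast
    rw [mul_div_cancel_left₀ _ (by positivity), zero_add]
  unfold clampedGrid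
  rw [this, min_eq_right ht, max_eq_right hst]

theorem clampedGrid_left (T s t : ℝ≥0) (n : ℕ) : clampedGrid T s t n 0 = s := by
  simp [clampedGrid, dyadicGrid]

/-- An increment is at most `T * (1/2) ^ n`, which ignores `t - s`, and at most `t - s`, which does
not decay in `n`. The geometric mean of the two bounds is small in both respects, at half the
exponent. -/
theorem dyadicScheme_clampedGrid {T s t : ℝ≥0} (hst : s ≤ t) (ht : t ≤ T) :
    DyadicScheme s t (clampedGrid T s t) (√(((t : ℝ) - s) * T)) (√(1 / 2)) where
  mono := clampedGrid_mono T s t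
  left := clampedGrid_left T s t
  right := clampedGrid_right hst ht
  nested n i := by simp only [clampedGrid, dyadicGrid_nested]
  mesh n i := by
    have h1 := clampedGrid_succ_sub_le T s t n i
    have hst' : (s : ℝ) ≤ t := hst
    have h2 : (clampedGrid T s t n (i + 1) : ℝ) - clampedGrid T s t n i ≤ t - s := by
      have a1 : (clampedGrid T s t n (i + 1) : ℝ) ≤ t := (clampedGrid_mem hst n (i + 1)).2
      have a2 : (s : ℝ) ≤ clampedGrid T s t n i := (clampedGrid_mem hst n i).1
      linarith
    have h3 : 0 ≤ (clampedGrid T s t n (i + 1) : ℝ) - clampedGrid T s t n i :=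
      sub_nonneg.2 (clampedGrid_mono T s t n (Nat.le_succ i))
    have e : √(((t : ℝ) - s) * T) * √(1 / 2) ^ n = √(((t : ℝ) - s) * (T * (1 / 2) ^ n)) := by
      rw [← mul_assoc, Real.sqrt_mul (x := ((t : ℝ) - s) * T)
        (mul_nonneg (by linarith) T.coe_nonneg)]
      congr 1
      rw [eq_comm, Real.sqrt_eq_iff_eq_sq (by positivity) (by positivity), ← pow_mul, mul_comm n 2,
        pow_mul, Real.sq_sqrt (by norm_num)]
    rw [e]
    refine Real.le_sqrt_of_sq_le ?_
    rw [sq]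
    exact mul_le_mul h2 h1 h3 (by linarith)

/-! ### Convergence of Riemann sums along nested dyadic partitions -/

section Scheme

variable {Ω : Type*} {mΩ : MeasurableSpace Ω} {P : Measure Ω} {𝓕 : Filtration ℝ≥0 mΩ}
  {m : ℝ} {T : ℝ≥0} {A : ℝ≥0 → ℝ≥0 → Ω → ℝ}

theorem partitionSum_two_mul_sub (A : ℝ≥0 → ℝ≥0 → Ω → ℝ) (a : ℕ → ℝ≥0) (N : ℕ) :
    partitionSum A a (2 * N) - partitionSum A (fun i => a (2 * i)) N
      = ∑ i ∈ Finset.range N, defect A (a (2 * i)) (a (2 * i + 1)) (a (2 * (i + 1))) := by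
  unfold partitionSum
  induction N with
  | zero => simp
  | succ n ih =>
    rw [show 2 * (n + 1) = 2 * n + 1 + 1 by ring, Finset.sum_range_succ, Finset.sum_range_succ,
      Finset.sum_range_succ _ n, Finset.sum_range_succ _ n, ← ih]
    unfold defect
    rw [show 2 * (n + 1) = 2 * n + 1 + 1 by ring]
    abel

theorem DyadicScheme.partitionSum_succ_sub {s t : ℝ≥0} {c : ℕ → ℕ → ℝ≥0} {h r : ℝ}
    (hc : DyadicScheme s t c h r) (n : ℕ) :
    partitionSum A (c (n + 1)) (2 ^ (n + 1)) - partitionSum A (c n) (2 ^ n)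
      = ∑ i ∈ Finset.range (2 ^ n), defect A (c n i) (c (n + 1) (2 * i + 1)) (c n (i + 1)) := by
  have := partitionSum_two_mul_sub A (c (n + 1)) (2 ^ n)
  simp only [hc.nested] at this
  rw [pow_succ', ← this]

/-- The constant in the sewing estimate. -/
def sewingConst (m : ℝ) (r β : ℝ) : ℝ≥0∞ :=
  3 * ENNReal.ofReal (2 * taylorConst m) / (1 - ENNReal.ofReal (r ^ β))

theorem sewingConst_ne_top {m r β : ℝ} (hr0 : 0 ≤ r) (hr : r < 1) (hβ : 0 < β) :
    sewingConst m r β ≠ ∞ := by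
  refine ENNReal.div_ne_top (by finiteness) (tsub_pos_of_lt ?_).ne'
  rw [← ENNReal.ofReal_one]
  exact (ENNReal.ofReal_lt_ofReal_iff one_pos).2 (Real.rpow_lt_one hr0 hr hβ)

variable [IsProbabilityMeasure P]

/-- Consecutive sums differ by a sum of defects over the intervals of level `n`, of order `(h
r^n)^(α - 1/2) (t - s)^(1/2)`. The series is geometric and starts from the sum of level zero, which
is `A s t` itself; the two parts of the bound correspond to this. -/
theorem DyadicScheme.exists_limit (hm : 2 ≤ m) (hA : IsGerm P 𝓕 m T A) {Γ : ℝ≥0} {α : ℝ}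
    (hα : 1 / 2 < α) (hb : GermBound P m T A Γ α) {s t : ℝ≥0} {c : ℕ → ℕ → ℝ≥0} {h r : ℝ}
    (hh : 0 ≤ h) (hr0 : 0 ≤ r) (hr : r < 1) (hc : DyadicScheme s t c h r) (ht : t ≤ T) :
    ∃ L : Ω → ℝ, MemLp L (ENNReal.ofReal m) P ∧
      Tendsto (fun n => eLpNorm (partitionSum A (c n) (2 ^ n) - L) (ENNReal.ofReal m) P)
        atTop (𝓝 0) ∧
      eLpNorm L (ENNReal.ofReal m) P ≤ Γ * (ENNReal.ofReal (((t : ℝ) - s) ^ α)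
        + sewingConst m r (α - 1 / 2)
          * ENNReal.ofReal (h ^ (α - 1 / 2) * ((t : ℝ) - s) ^ (1 / 2 : ℝ))) := by
  have hβ : 0 < α - 1 / 2 := by linarith
  have hst : s ≤ t := by
    rw [← hc.left 0, ← hc.right 0]
    exact hc.mono 0 (Nat.zero_le _)
  have hS : ∀ n, MemLp (partitionSum A (c n) (2 ^ n)) (ENNReal.ofReal m) P := fun n =>
    hA.memLp_partitionSum (hc.mono n) ((hc.right n).trans_le ht)
  have hstep : ∀ n, eLpNorm (partitionSum A (c (n + 1)) (2 ^ (n + 1))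
      - partitionSum A (c n) (2 ^ n)) (ENNReal.ofReal m) P ≤
      (ENNReal.ofReal (2 * taylorConst m) * (3 * Γ : ℝ≥0)
        * ENNReal.ofReal (h ^ (α - 1 / 2) * ((t : ℝ) - s) ^ (1 / 2 : ℝ)))
        * ENNReal.ofReal (r ^ (α - 1 / 2)) ^ n := by
    intro n
    rw [hc.partitionSum_succ_sub]
    have h1 := eLpNorm_sum_defect_le hm hA hα hb (a := c n) (u := fun i => c (n + 1) (2 * i + 1))
      (N := 2 ^ n) (hc.mono n) (fun i => by
        rw [← hc.nested]; exact hc.mono _ (Nat.le_succ _))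
      (fun i => by
        rw [← hc.nested n (i + 1)]
        exact hc.mono _ (show 2 * i + 1 ≤ 2 * (i + 1) by omega)) ((hc.right n).trans_le ht)
      (h := h * r ^ n) (by positivity) (fun i _ => hc.mesh n i)
    refine h1.trans_eq ?_
    rw [hc.right, hc.left, mul_assoc (ENNReal.ofReal (2 * taylorConst m) * _), ←
      ENNReal.ofReal_pow (by positivity), ← ENNReal.ofReal_mul (by
        have : (s : ℝ) ≤ t := hst
        have : 0 ≤ (t : ℝ) - s := by linarith
        positivity)]
    congr 2
    rw [Real.mul_rpow hh (by positivity), ← Real.rpow_natCast, ← Real.rpow_natCast,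
      ← Real.rpow_mul hr0, ← Real.rpow_mul hr0]
    ring_nf
  obtain ⟨L, hL, hlim, hbound⟩ := exists_limit_of_geometric (one_le_ofReal hm) hS
    (by finiteness) (by
      rw [← ENNReal.ofReal_one]
      exact (ENNReal.ofReal_lt_ofReal_iff one_pos).2 (Real.rpow_lt_one hr0 hr hβ)) hstep
  refine ⟨L, hL, hlim, ?_⟩
  have h0 : partitionSum A (c 0) (2 ^ 0) = A s t := by
    have := hc.right 0
    rw [pow_zero] at this
    simp [partitionSum, hc.left, this]
  rw [h0] at hbound
  have h2 : L = A s t + (L - A s t) := by abel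
  rw [h2]
  refine (eLpNorm_add_le (hA.memLp s t hst ht).1 (hL.sub (hA.memLp s t hst ht)).1
    (one_le_ofReal hm)).trans ?_
  rw [mul_add]
  refine add_le_add (hb s t hst ht) (hbound.trans_eq ?_)
  unfold sewingConst
  push_cast
  simp only [div_eq_mul_inv]
  ring

end Scheme

/-- The factor `(2 ^ n) ^ γ` counts intervals: `γ = 1/2` for martingale differences, `γ = 1` for the
triangle inequality, and `γ = 0` when only the mesh enters. -/
theorem tendsto_dyadic_rpow {γ β : ℝ} (h : γ < β) {x : ℝ} (hx : 0 ≤ x) :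
    Tendsto (fun n : ℕ => ((2 : ℝ) ^ n) ^ γ * (x * (1 / 2) ^ n) ^ β) atTop (𝓝 0) := by
  have e : ∀ n : ℕ, ((2 : ℝ) ^ n) ^ γ * (x * (1 / 2) ^ n) ^ β
      = x ^ β * (((2 : ℝ) ^ (γ - β)) ^ n) := by
    intro n
    rw [Real.mul_rpow hx (by positivity), one_div, inv_pow, Real.inv_rpow (by positivity),
      ← Real.rpow_neg (by positivity), mul_left_comm, ← Real.rpow_add (by positivity),
      ← sub_eq_add_neg, ← Real.rpow_natCast, ← Real.rpow_natCast, ← Real.rpow_mul (by norm_num),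
      ← Real.rpow_mul (by norm_num), mul_comm (n : ℝ)]
  simp_rw [e]
  rw [← mul_zero (x ^ β)]
  refine (tendsto_pow_atTop_nhds_zero_of_lt_one (by positivity) ?_).const_mul _
  exact Real.rpow_lt_one_of_one_lt_of_neg (by norm_num) (by linarith)

/-! ### Existence, uniqueness and increment bounds of sewings -/

section Sewing

variable {Ω : Type*} {mΩ : MeasurableSpace Ω} {P : Measure Ω} [IsProbabilityMeasure P]
  {𝓕 : Filtration ℝ≥0 mΩ} {m : ℝ} {T : ℝ≥0} {A : ℝ≥0 → ℝ≥0 → Ω → ℝ}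

/-- Conditioned on the first time, each term becomes a difference of germs with the common left
endpoint `a 0`, and the sum telescopes. -/
theorem IsGerm.condExp_partitionSum (hm : 2 ≤ m) (hA : IsGerm P 𝓕 m T A) {a : ℕ → ℝ≥0}
    (ha : Monotone a) (N : ℕ) (haT : a N ≤ T) :
    P[partitionSum A a N | 𝓕 (a 0)] =ᵐ[P] A (a 0) (a N) := by
  induction N with
  | zero =>
    have h1 : partitionSum A a 0 = 0 := by simp [partitionSum]
    rw [h1, condExp_zero]
    exact (hA.self_eq_zero hm haT).symm
  | succ n ih =>
    have hn := ha (Nat.le_succ n)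
    have h1 : partitionSum A a (n + 1) = partitionSum A a n + A (a n) (a (n + 1)) :=
      Finset.sum_range_succ _ _
    rw [h1]
    have h2 := condExp_add (μ := P) (m := 𝓕 (a 0))
      ((hA.memLp_partitionSum ha (hn.trans haT)).integrable (one_le_ofReal hm))
      (hA.integrable hm hn haT)
    filter_upwards [h2, ih (hn.trans haT), hA.condExp_eq (a 0) (a n) (a (n + 1))
      (ha (Nat.zero_le _)) hn haT] with ω h2 h3 h4
    rw [h2, Pi.add_apply, h3, h4]
    simp

/-- All Riemann sums have the same conditional mean `A s t`, and conditional expectation is an `L^m`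
contraction. The second sewing bound thus holds with left side zero. -/
theorem DyadicScheme.condExp_limit (hm : 2 ≤ m) (hA : IsGerm P 𝓕 m T A) {s t : ℝ≥0}
    {c : ℕ → ℕ → ℝ≥0} {h r : ℝ} (hc : DyadicScheme s t c h r) (ht : t ≤ T) {L : Ω → ℝ}
    (hL : MemLp L (ENNReal.ofReal m) P)
    (hlim : Tendsto (fun n => eLpNorm (partitionSum A (c n) (2 ^ n) - L) (ENNReal.ofReal m) P)
      atTop (𝓝 0)) : P[L | 𝓕 s] =ᵐ[P] A s t := by
  have hst : s ≤ t := by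
    rw [← hc.left 0, ← hc.right 0]
    exact hc.mono 0 (Nat.zero_le _)
  have hS : ∀ n, MemLp (partitionSum A (c n) (2 ^ n)) (ENNReal.ofReal m) P := fun n =>
    hA.memLp_partitionSum (hc.mono n) ((hc.right n).trans_le ht)
  have h1 := tendsto_eLpNorm_condExp (one_le_ofReal hm) hS hL (𝓕 s) hlim
  have hE : ∀ n, P[partitionSum A (c n) (2 ^ n) | 𝓕 s] =ᵐ[P] A s t := by
    intro n
    have := hA.condExp_partitionSum hm (hc.mono n) (2 ^ n) ((hc.right n).trans_le ht)
    rwa [hc.left, hc.right] at this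
  refine eLpNorm_sub_eq_zero_of_tendsto (one_le_ofReal hm)
    (fun n => integrable_condExp.aestronglyMeasurable) integrable_condExp.aestronglyMeasurable
    (hA.memLp s t hst ht).1 h1 ?_
  refine tendsto_const_nhds.congr fun n => ?_
  rw [eLpNorm_congr_ae ((hE n).sub (EventuallyEq.refl _ (A s t))), sub_self, eLpNorm_zero]

/-- The contributions of one grid cell `[x, y]` to the sums over `[0, s]`, `[s, t]` and `[0, t]`
combine into a single defect, cut at `s` truncated to the cell. If `s` is not interior, only
degenerate intervals remain, where `A` vanishes almost surely. -/
theorem IsGerm.clamp_defect (hm : 2 ≤ m) (hA : IsGerm P 𝓕 m T A) {s t : ℝ≥0} (hst : s ≤ t)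
    (ht : t ≤ T) {x y : ℝ≥0} (hxy : x ≤ y) :
    A (max 0 (min x s)) (max 0 (min y s)) + A (max s (min x t)) (max s (min y t))
      - A (max 0 (min x t)) (max 0 (min y t))
      =ᵐ[P] defect A (max 0 (min x t)) (max (max 0 (min x t)) (min s (max 0 (min y t))))
        (max 0 (min y t)) := by
  simp only [zero_le, max_eq_right]
  unfold defect
  rcases le_total y s with hys | hsy
  · have hxs := hxy.trans hys
    have e1 : min x s = x := min_eq_left hxs
    have e2 : min y s = y := min_eq_left hys
    have e3 : min x t = x := min_eq_left (hxs.trans hst)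
    have e4 : min y t = y := min_eq_left (hys.trans hst)
    rw [e1, e2, e3, e4, max_eq_left hxs, max_eq_left hys, min_eq_right hys, max_eq_right hxy]
    filter_upwards [hA.self_eq_zero hm (hst.trans ht), hA.self_eq_zero hm ((hys.trans hst).trans ht)]
      with ω h1 h2
    simp [h1, h2]
  · rcases le_total s x with hsx | hxs
    · have e1 : min x s = s := min_eq_right hsx
      have e2 : min y s = s := min_eq_right hsy
      have e3 : s ≤ min x t := le_min hsx hst
      have e4 : s ≤ min y t := le_min hsy hst
      rw [e1, e2, max_eq_right e3, max_eq_right e4, min_eq_left e4, max_eq_left e3]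
      filter_upwards [hA.self_eq_zero hm (hst.trans ht),
        hA.self_eq_zero hm ((min_le_right x t).trans ht)] with ω h1 h2
      simp [h1, h2]
    · have e1 : min x s = x := min_eq_left hxs
      have e2 : min y s = s := min_eq_right hsy
      have e3 : min x t = x := min_eq_left (hxs.trans hst)
      have e4 : s ≤ min y t := le_min hsy hst
      rw [e1, e2, e3, max_eq_left hxs, max_eq_right e4, min_eq_left e4, max_eq_right hxs]

/-- The three sums come from one partition of `[0, T]`, so their additivity error is a sum of
defects over cells of vanishing mesh. This is the reason for restricting a global grid. -/
theorem clampedGrid_limit_add (hm : 2 ≤ m) (hA : IsGerm P 𝓕 m T A) {Γ : ℝ≥0} {α : ℝ}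
    (hα : 1 / 2 < α) (hb : GermBound P m T A Γ α) {s t : ℝ≥0} (hst : s ≤ t) (ht : t ≤ T)
    {L₁ L₂ L₃ : Ω → ℝ} (h₁ : MemLp L₁ (ENNReal.ofReal m) P) (h₂ : MemLp L₂ (ENNReal.ofReal m) P)
    (h₃ : MemLp L₃ (ENNReal.ofReal m) P)
    (l₁ : Tendsto (fun n => eLpNorm (partitionSum A (clampedGrid T 0 s n) (2 ^ n) - L₁)
      (ENNReal.ofReal m) P) atTop (𝓝 0))
    (l₂ : Tendsto (fun n => eLpNorm (partitionSum A (clampedGrid T s t n) (2 ^ n) - L₂)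
      (ENNReal.ofReal m) P) atTop (𝓝 0))
    (l₃ : Tendsto (fun n => eLpNorm (partitionSum A (clampedGrid T 0 t n) (2 ^ n) - L₃)
      (ENNReal.ofReal m) P) atTop (𝓝 0)) :
    L₃ - L₁ =ᵐ[P] L₂ := by
  have hp := one_le_ofReal hm
  have hβ : 0 < α - 1 / 2 := by linarith
  have M : ∀ (u v : ℝ≥0), u ≤ v → v ≤ T → ∀ n,
      MemLp (partitionSum A (clampedGrid T u v n) (2 ^ n)) (ENNReal.ofReal m) P :=
    fun u v huv hv n => hA.memLp_partitionSum (clampedGrid_mono _ _ _ _)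
      ((clampedGrid_right huv hv n).trans_le hv)
  have M₁ := M 0 s (zero_le) (hst.trans ht)
  have M₂ := M s t hst ht
  have M₃ := M 0 t (zero_le) ht
  have hdef : Tendsto (fun n => eLpNorm (partitionSum A (clampedGrid T 0 s n) (2 ^ n)
      + partitionSum A (clampedGrid T s t n) (2 ^ n)
      - partitionSum A (clampedGrid T 0 t n) (2 ^ n)) (ENNReal.ofReal m) P) atTop (𝓝 0) := by
    have hbd : ∀ n, eLpNorm (partitionSum A (clampedGrid T 0 s n) (2 ^ n)
      + partitionSum A (clampedGrid T s t n) (2 ^ n)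
      - partitionSum A (clampedGrid T 0 t n) (2 ^ n)) (ENNReal.ofReal m) P ≤
        ENNReal.ofReal (2 * taylorConst m) * (3 * Γ : ℝ≥0)
        * ENNReal.ofReal ((T * (1 / 2) ^ n : ℝ) ^ (α - 1 / 2) * (t : ℝ) ^ (1 / 2 : ℝ)) := by
      intro n
      set a := clampedGrid T 0 t n with ha
      set u : ℕ → ℝ≥0 := fun i => max (a i) (min s (a (i + 1))) with hu
      have hamono : Monotone a := clampedGrid_mono T 0 t n
      have e : partitionSum A (clampedGrid T 0 s n) (2 ^ n)
          + partitionSum A (clampedGrid T s t n) (2 ^ n) - partitionSum A a (2 ^ n)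
          =ᵐ[P] ∑ i ∈ Finset.range (2 ^ n), defect A (a i) (u i) (a (i + 1)) := by
        unfold partitionSum
        rw [← Finset.sum_add_distrib, ← Finset.sum_sub_distrib]
        have h0 : ∀ i, A (clampedGrid T 0 s n i) (clampedGrid T 0 s n (i + 1))
            + A (clampedGrid T s t n i) (clampedGrid T s t n (i + 1)) - A (a i) (a (i + 1))
            =ᵐ[P] defect A (a i) (u i) (a (i + 1)) := fun i =>
          hA.clamp_defect hm hst ht (dyadicGrid_mono 0 T n (Nat.le_succ i))
        filter_upwards [ae_all_iff.2 h0] with ω hω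
        simp only [Finset.sum_apply]
        exact Finset.sum_congr rfl fun i _ => hω i
      rw [eLpNorm_congr_ae e]
      have h1 := eLpNorm_sum_defect_le hm hA hα hb (N := 2 ^ n) hamono
        (fun i => le_max_left (a i) (min s (a (i + 1))))
        (fun i => max_le (hamono (Nat.le_succ i)) (min_le_right _ _))
        ((clampedGrid_right (zero_le) ht n).trans_le ht) (h := T * (1 / 2) ^ n) (by positivity)
        (fun i _ => clampedGrid_succ_sub_le T 0 t n i)
      rw [ha, clampedGrid_right (zero_le) ht, clampedGrid_left] at h1
      simpa using h1
    refine tendsto_of_tendsto_of_tendsto_of_le_of_le tendsto_const_nhds ?_ (fun _ => bot_le) hbd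
    have h1 := tendsto_dyadic_rpow hβ T.coe_nonneg
    simp only [Real.rpow_zero, one_mul] at h1
    have h2 := ENNReal.tendsto_ofReal (h1.mul_const ((t : ℝ) ^ (1 / 2 : ℝ)))
    have h3 := ENNReal.Tendsto.const_mul
      (a := ENNReal.ofReal (2 * taylorConst m) * (3 * Γ : ℝ≥0)) h2 (Or.inr (by finiteness))
    simpa using h3
  refine eLpNorm_sub_eq_zero_of_tendsto hp (S := fun n =>
    partitionSum A (clampedGrid T s t n) (2 ^ n)) (fun n => (M₂ n).1) (h₃.sub h₁).1 h₂.1 ?_ l₂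
  have hsum := (hdef.add l₁).add l₃
  simp only [add_zero] at hsum
  refine tendsto_of_tendsto_of_tendsto_of_le_of_le tendsto_const_nhds hsum (fun _ => bot_le)
    fun n => ?_
  dsimp only
  set S₁ := partitionSum A (clampedGrid T 0 s n) (2 ^ n)
  set S₂ := partitionSum A (clampedGrid T s t n) (2 ^ n)
  set S₃ := partitionSum A (clampedGrid T 0 t n) (2 ^ n)
  have e : S₂ - (L₃ - L₁) = ((S₁ + S₂ - S₃) - (S₁ - L₁)) + (S₃ - L₃) := by abel
  have m1 := (((M₁ n).add (M₂ n)).sub (M₃ n)).1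
  have m2 := ((M₁ n).sub h₁).1
  have m3 := ((M₃ n).sub h₃).1
  rw [e]
  exact (eLpNorm_add_le (m1.sub m2) m3 hp).trans
    (add_le_add (eLpNorm_sub_le m1 m2 hp) le_rfl)

/-- Existence part of the stochastic sewing lemma. -/
theorem exists_isSewing (hm : 2 ≤ m) (hA : IsGerm P 𝓕 m T A) {Γ : ℝ≥0} {α : ℝ}
    (hα : 1 / 2 < α) (hb : GermBound P m T A Γ α) : ∃ φ, IsSewing P 𝓕 m T A φ := by
  have hp := one_le_ofReal hm
  have hβ : 0 < α - 1 / 2 := by linarith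
  have hr : √(1 / 2 : ℝ) < 1 := by
    rw [Real.sqrt_lt' one_pos]
    norm_num
  have hex : ∀ s t : ℝ≥0, ∃ L : Ω → ℝ, s ≤ t → t ≤ T → MemLp L (ENNReal.ofReal m) P ∧
      Tendsto (fun n => eLpNorm (partitionSum A (clampedGrid T s t n) (2 ^ n) - L)
        (ENNReal.ofReal m) P) atTop (𝓝 0) ∧
      eLpNorm L (ENNReal.ofReal m) P ≤ Γ * (ENNReal.ofReal (((t : ℝ) - s) ^ α)
        + sewingConst m (√(1 / 2)) (α - 1 / 2)
          * ENNReal.ofReal ((√(((t : ℝ) - s) * T)) ^ (α - 1 / 2)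
            * ((t : ℝ) - s) ^ (1 / 2 : ℝ))) := by
    intro s t
    by_cases h : s ≤ t ∧ t ≤ T
    · obtain ⟨L, hL⟩ := (dyadicScheme_clampedGrid h.1 h.2).exists_limit hm hA hα hb (by positivity)
        (by positivity) hr h.2
      exact ⟨L, fun _ _ => hL⟩
    · exact ⟨0, fun h1 h2 => absurd ⟨h1, h2⟩ h⟩
  choose L hL using hex
  have hLmem : ∀ s t, s ≤ t → t ≤ T → MemLp (L s t) (ENNReal.ofReal m) P :=
    fun s t h1 h2 => (hL s t h1 h2).1
  -- Half of the excess over `1/2` survives the geometric mean in the mesh bound.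
  set ε := (α - 1 / 2) / 2 with hε
  set K : ℝ≥0∞ := Γ * (ENNReal.ofReal ((T : ℝ) ^ ε)
    + sewingConst m (√(1 / 2)) (α - 1 / 2) * ENNReal.ofReal ((T : ℝ) ^ ε)) with hK
  have hKtop : K ≠ ∞ := by
    have := sewingConst_ne_top (m := m) (r := √(1 / 2)) (by positivity) hr hβ
    finiteness
  have hbound : ∀ s t, s ≤ t → t ≤ T → eLpNorm (L s t) (ENNReal.ofReal m) P
      ≤ K * ENNReal.ofReal (((t : ℝ) - s) ^ (1 / 2 + ε)) := by
    intro s t hst ht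
    refine (hL s t hst ht).2.2.trans ?_
    have hst' : (s : ℝ) ≤ t := hst
    have ht' : (t : ℝ) ≤ T := ht
    have hx : 0 ≤ (t : ℝ) - s := by linarith
    have hxT : (t : ℝ) - s ≤ T := by linarith [s.coe_nonneg]
    generalize (t : ℝ) - s = x at *
    have h1 : x ^ α ≤ (T : ℝ) ^ ε * x ^ (1 / 2 + ε) := by
      rcases hx.eq_or_lt with rfl | hx0
      · rw [Real.zero_rpow (by linarith)]
        positivity
      · rw [show α = ε + (1 / 2 + ε) by rw [hε]; ring, Real.rpow_add hx0]
        gcongr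
    have h2 : (√(x * T)) ^ (α - 1 / 2) * x ^ (1 / 2 : ℝ) = (T : ℝ) ^ ε * x ^ (1 / 2 + ε) := by
      rw [Real.rpow_add' hx (by positivity), Real.sqrt_eq_rpow,
        ← Real.rpow_mul (mul_nonneg hx T.coe_nonneg),
        show 1 / 2 * (α - 1 / 2) = ε by rw [hε]; ring, Real.mul_rpow hx T.coe_nonneg]
      ring
    rw [h2, hK, mul_assoc, add_mul, mul_assoc, ← ENNReal.ofReal_mul (by positivity)]
    gcongr
  have hadd : ∀ s t, s ≤ t → t ≤ T → L 0 t - L 0 s =ᵐ[P] L s t := by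
    intro s t hst ht
    have a1 := hL 0 s (zero_le) (hst.trans ht)
    have a2 := hL s t hst ht
    have a3 := hL 0 t (zero_le) ht
    exact clampedGrid_limit_add hm hA hα hb hst ht a1.1 a2.1 a3.1 a1.2.1 a2.2.1 a3.2.1
  have hadapt : ∀ t ≤ T, P[L 0 t | 𝓕 t] =ᵐ[P] L 0 t := by
    intro t ht
    have a := hL 0 t (zero_le) ht
    have hS : ∀ n, MemLp (partitionSum A (clampedGrid T 0 t n) (2 ^ n)) (ENNReal.ofReal m) P :=
      fun n => hA.memLp_partitionSum (clampedGrid_mono _ _ _ _)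
        ((clampedGrid_right (zero_le) ht n).trans_le ht)
    have h1 := tendsto_eLpNorm_condExp hp hS a.1 (𝓕 t) a.2.1
    refine eLpNorm_sub_eq_zero_of_tendsto hp (fun n => (hS n).1)
      integrable_condExp.aestronglyMeasurable a.1.1 (h1.congr fun n => ?_) a.2.1
    rw [condExp_of_stronglyMeasurable (𝓕.le t) ?_ ((hS n).integrable hp)]
    refine Finset.stronglyMeasurable_sum _ fun i _ => ?_
    have hle := fun j => (clampedGrid_mem (T := T) (s := 0) (zero_le) n j : _ ∧ _ ≤ t).2
    exact (hA.stronglyMeasurable _ _ (clampedGrid_mono T 0 t n (Nat.le_succ i))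
      ((hle _).trans ht)).mono (𝓕.mono (hle i))
  have hinc : ∀ s t, s ≤ t → t ≤ T → P[L 0 t | 𝓕 t] - P[L 0 s | 𝓕 s] =ᵐ[P] L s t :=
    fun s t hst ht => ((hadapt t ht).sub (hadapt s (hst.trans ht))).trans (hadd s t hst ht)
  -- The limit is determined only almost everywhere; conditioning on `𝓕 t` selects an adapted
  -- version of it, by `hadapt`.
  refine ⟨fun t => P[L 0 t | 𝓕 t], ⟨?_, ?_, ?_, ε, by positivity, K.toNNReal, ?_⟩⟩
  · refine (hadapt 0 (zero_le)).trans ?_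
    have h0 := hbound 0 0 le_rfl (zero_le)
    rw [sub_self, Real.zero_rpow (by positivity), ENNReal.ofReal_zero, mul_zero] at h0
    exact (eLpNorm_eq_zero_iff (hLmem 0 0 le_rfl (zero_le)).1 (by positivity)).1
      (le_antisymm h0 bot_le)
  · exact fun t ht => stronglyMeasurable_condExp
  · exact fun t ht => (memLp_congr_ae (hadapt t ht)).2 (hLmem 0 t (zero_le) ht)
  · intro s t hst ht
    rw [ENNReal.coe_toNNReal hKtop]
    constructor
    · exact (eLpNorm_congr_ae (hinc s t hst ht)).trans_le (hbound s t hst ht)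
    · have h1 : (fun ω => P[L 0 t | 𝓕 t] ω - P[L 0 s | 𝓕 s] ω - A s t ω) =ᵐ[P] L s t - A s t :=
        (hinc s t hst ht).sub (EventuallyEq.refl _ (A s t))
      have h2 := (dyadicScheme_clampedGrid hst ht).condExp_limit hm hA ht (hLmem s t hst ht)
        (hL s t hst ht).2.1
      have h3 := condExp_sub ((hLmem s t hst ht).integrable hp) (hA.integrable hm hst ht) (𝓕 s)
      have h4 := condExp_of_stronglyMeasurable (𝓕.le s) (hA.stronglyMeasurable s t hst ht)
        (hA.integrable hm hst ht)
      have h5 : P[fun ω => P[L 0 t | 𝓕 t] ω - P[L 0 s | 𝓕 s] ω - A s t ω | 𝓕 s] =ᵐ[P] 0 := by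
        refine (condExp_congr_ae h1).trans (h3.trans ?_)
        rw [h4]
        filter_upwards [h2] with ω h2
        simp [h2]
      rw [eLpNorm_congr_ae h5, eLpNorm_zero]
      exact bot_le

/-- The increments of a process obtained by sewing are the limits of dyadic sums. -/
theorem IsSewing.tendsto_partitionSum (hm : 2 ≤ m) (hA : IsGerm P 𝓕 m T A) {Γ : ℝ≥0} {α : ℝ}
    (hα : 1 / 2 < α) (hb : GermBound P m T A Γ α) {φ : ℝ≥0 → Ω → ℝ} (hφ : IsSewing P 𝓕 m T A φ)
    {s t : ℝ≥0} (hst : s ≤ t) (ht : t ≤ T) :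
    Tendsto (fun n => eLpNorm (partitionSum A (dyadicGrid s (t - s) n) (2 ^ n) - (φ t - φ s))
      (ENNReal.ofReal m) P) atTop (𝓝 0) := by
  have hp := one_le_ofReal hm
  obtain ⟨ε, hε, K, hK⟩ := hφ.bounds
  have hsch := dyadicScheme_grid hst
  set x : ℝ := ((t - s : ℝ≥0) : ℝ) with hx
  have hx0 : 0 ≤ x := NNReal.coe_nonneg _
  set b : ℕ → ℝ := fun n => (x * (1 / 2) ^ n) ^ (1 / 2 + ε) + (x * (1 / 2) ^ n) ^ (1 + ε)
    + (x * (1 / 2) ^ n) ^ α with hbdef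
  have hbound : ∀ n, eLpNorm (partitionSum A (dyadicGrid s (t - s) n) (2 ^ n) - (φ t - φ s))
      (ENNReal.ofReal m) P ≤
      ENNReal.ofReal (2 * taylorConst m) * (K + Γ : ℝ≥0)
        * ENNReal.ofReal (((2 : ℝ) ^ n) ^ (1 / 2 : ℝ) * b n)
      + K * ENNReal.ofReal (((2 : ℝ) ^ n) ^ (1 : ℝ) * (x * (1 / 2) ^ n) ^ (1 + ε)) := by
    intro n
    set c := dyadicGrid s (t - s) n with hc
    have hcm : Monotone c := dyadicGrid_mono _ _ _
    have hδ : ∀ i, (c (i + 1) : ℝ) - c i = x * (1 / 2) ^ n := dyadicGrid_succ_sub _ _ _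
    set δ : ℝ := x * (1 / 2) ^ n with hδdef
    have hδ0 : 0 ≤ δ := by positivity
    have hcT : ∀ i < 2 ^ n, c (i + 1) ≤ T := fun i hi =>
      (hcm (Nat.succ_le_of_lt hi)).trans ((hsch.right n).trans_le ht)
    have hci : ∀ i, c i ≤ c (i + 1) := fun i => hcm (Nat.le_succ i)
    -- The local errors of the approximation. Their centred parts are martingale differences and
    -- cost a factor `√(2 ^ n)`; their conditional means are summed by the triangle inequality at
    -- cost `2 ^ n`, which the exponent `1 + ε` beats.
    set R : ℕ → Ω → ℝ := fun i => φ (c (i + 1)) - φ (c i) - A (c i) (c (i + 1)) with hR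
    have hRmem : ∀ i < 2 ^ n, MemLp (R i) (ENNReal.ofReal m) P := fun i hi =>
      ((hφ.memLp _ (hcT i hi)).sub (hφ.memLp _ ((hci i).trans (hcT i hi)))).sub
        (hA.memLp _ _ (hci i) (hcT i hi))
    have hE : ∀ i < 2 ^ n, eLpNorm (P[R i | 𝓕 (c i)]) (ENNReal.ofReal m) P
        ≤ K * ENNReal.ofReal (δ ^ (1 + ε)) := by
      intro i hi
      have := (hK (c i) (c (i + 1)) (hci i) (hcT i hi)).2
      rwa [hδ] at this
    have hRb : ∀ i < 2 ^ n, eLpNorm (R i) (ENNReal.ofReal m) P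
        ≤ K * ENNReal.ofReal (δ ^ (1 / 2 + ε)) + Γ * ENNReal.ofReal (δ ^ α) := by
      intro i hi
      have h1 := (hK (c i) (c (i + 1)) (hci i) (hcT i hi)).1
      have h2 := hb (c i) (c (i + 1)) (hci i) (hcT i hi)
      rw [hδ] at h1 h2
      exact (eLpNorm_sub_le ((hφ.memLp _ (hcT i hi)).sub
        (hφ.memLp _ ((hci i).trans (hcT i hi)))).1 (hA.memLp _ _ (hci i) (hcT i hi)).1 hp).trans
          (add_le_add h1 h2)
    have hCE : ∀ i < 2 ^ n, MemLp (P[R i | 𝓕 (c i)]) (ENNReal.ofReal m) P := fun i hi =>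
      ⟨integrable_condExp.aestronglyMeasurable, (hE i hi).trans_lt (by finiteness)⟩
    have hD := eLpNorm_sum_le_of_martingaleDifference hm (P := P)
      (D := fun i => R i - P[R i | 𝓕 (c i)]) (G := fun i => 𝓕 (c i)) (N := 2 ^ n)
      (fun i => 𝓕.le _) (fun i j hij => 𝓕.mono (hcm hij))
      (fun i hi => (((hφ.adapted _ (hcT i hi)).sub ((hφ.adapted _ ((hci i).trans (hcT i hi))).mono
        (𝓕.mono (hci i)))).sub ((hA.stronglyMeasurable _ _ (hci i) (hcT i hi)).mono
        (𝓕.mono (hci i)))).sub (stronglyMeasurable_condExp.mono (𝓕.mono (hci i))))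
      (fun i hi => (hRmem i hi).sub (hCE i hi))
      (fun i hi => by
        have h1 := condExp_sub ((hRmem i hi).integrable hp)
          (integrable_condExp (μ := P) (m := 𝓕 (c i)) (f := R i)) (𝓕 (c i))
        rw [condExp_of_stronglyMeasurable (𝓕.le (c i)) (stronglyMeasurable_condExp (f := R i))
          integrable_condExp, sub_self] at h1
        exact h1)
      (Γ := K + Γ) (b := fun _ => b n) (fun _ _ => by positivity)
      (fun i hi => by
        refine (eLpNorm_sub_le (hRmem i hi).1 (hCE i hi).1 hp).trans
          ((add_le_add (hRb i hi) (hE i hi)).trans ?_)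
        simp only [hbdef]
        rw [ENNReal.ofReal_add (by positivity) (by positivity),
          ENNReal.ofReal_add (by positivity) (by positivity), ENNReal.coe_add]
        generalize ENNReal.ofReal (δ ^ (1 / 2 + ε)) = y₁
        generalize ENNReal.ofReal (δ ^ (1 + ε)) = y₂
        generalize ENNReal.ofReal (δ ^ α) = y₃
        calc (K : ℝ≥0∞) * y₁ + Γ * y₃ + K * y₂
            ≤ (K * y₁ + Γ * y₃ + K * y₂) + (K * y₃ + Γ * y₁ + Γ * y₂) := le_self_add
          _ = _ := by ring)
      (B := ((2 : ℝ) ^ n) ^ (1 / 2 : ℝ) * b n) (by positivity)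
      (by
        rw [Finset.sum_const, Finset.card_range, mul_pow, ← Real.sqrt_eq_rpow,
          Real.sq_sqrt (by positivity)]
        simp)
    have hsumE : eLpNorm (∑ i ∈ Finset.range (2 ^ n), P[R i | 𝓕 (c i)]) (ENNReal.ofReal m) P
        ≤ K * ENNReal.ofReal (((2 : ℝ) ^ n) ^ (1 : ℝ) * δ ^ (1 + ε)) := by
      refine (eLpNorm_sum_le (fun i hi => (hCE i (Finset.mem_range.1 hi)).1) hp).trans ?_
      refine (Finset.sum_le_sum fun i hi => hE i (Finset.mem_range.1 hi)).trans_eq ?_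
      rw [Finset.sum_const, Finset.card_range, Real.rpow_one, ENNReal.ofReal_mul (by positivity),
        nsmul_eq_mul, ENNReal.ofReal_pow (by norm_num)]
      push_cast
      simp only [ENNReal.ofReal_ofNat]
      ring
    have htel : partitionSum A c (2 ^ n) - (φ t - φ s)
        = -(∑ i ∈ Finset.range (2 ^ n), (R i - P[R i | 𝓕 (c i)])
          + ∑ i ∈ Finset.range (2 ^ n), P[R i | 𝓕 (c i)]) := by
      rw [← Finset.sum_add_distrib]
      simp only [sub_add_cancel, hR]
      rw [Finset.sum_sub_distrib, Finset.sum_range_sub (fun i => φ (c i)), show c 0 = s from hsch.left n,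
        show c (2 ^ n) = t from hsch.right n]
      unfold partitionSum
      abel
    rw [htel, eLpNorm_neg]
    refine (eLpNorm_add_le ?_ ?_ hp).trans (add_le_add hD hsumE)
    · exact (memLp_finsetSum' _ fun i hi => (hRmem i (Finset.mem_range.1 hi)).sub
        (hCE i (Finset.mem_range.1 hi))).1
    · exact (memLp_finsetSum' _ fun i hi => hCE i (Finset.mem_range.1 hi)).1
  refine tendsto_of_tendsto_of_tendsto_of_le_of_le tendsto_const_nhds ?_ (fun _ => bot_le) hbound
  have t1 := tendsto_dyadic_rpow (γ := 1 / 2) (β := 1 / 2 + ε) (by linarith) hx0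
  have t2 := tendsto_dyadic_rpow (γ := 1 / 2) (β := 1 + ε) (by linarith) hx0
  have t3 := tendsto_dyadic_rpow (γ := 1 / 2) (β := α) hα hx0
  have t4 := tendsto_dyadic_rpow (γ := 1) (β := 1 + ε) (by linarith) hx0
  have t5 := (t1.add t2).add t3
  simp only [add_zero, ← mul_add] at t5
  have t6 := ENNReal.Tendsto.const_mul
      (a := ENNReal.ofReal (2 * taylorConst m) * (K + Γ : ℝ≥0)) (ENNReal.tendsto_ofReal t5)
      (Or.inr (by finiteness))
  have t7 := ENNReal.Tendsto.const_mul (a := (K : ℝ≥0∞)) (ENNReal.tendsto_ofReal t4)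
      (Or.inr (by finiteness))
  simpa [hbdef] using t6.add t7

/-- The constant in the `L^m` bound of the increments of a process obtained by sewing. -/
def incrementConst (m α : ℝ) : ℝ≥0∞ := 1 + sewingConst m (1 / 2) (α - 1 / 2)

theorem incrementConst_ne_top {m α : ℝ} (hα : 1 / 2 < α) : incrementConst m α ≠ ∞ := by
  have := sewingConst_ne_top (m := m) (r := 1 / 2) (β := α - 1 / 2) (by norm_num) (by norm_num)
    (by linarith)
  unfold incrementConst
  finiteness

/-- The increment is the limit along the dyadic partitions of `[s, t]` itself, of mesh `(t - s)
2^{-n}`, so the full power `α` is recovered. The `ε` and `K` of the definition of a sewing do not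
enter the bound. -/
theorem IsSewing.eLpNorm_sub_le (hm : 2 ≤ m) (hA : IsGerm P 𝓕 m T A) {Γ : ℝ≥0} {α : ℝ}
    (hα : 1 / 2 < α) (hb : GermBound P m T A Γ α) {φ : ℝ≥0 → Ω → ℝ} (hφ : IsSewing P 𝓕 m T A φ)
    {s t : ℝ≥0} (hst : s ≤ t) (ht : t ≤ T) :
    eLpNorm (φ t - φ s) (ENNReal.ofReal m) P
      ≤ incrementConst m α * Γ * ENNReal.ofReal (((t : ℝ) - s) ^ α) := by
  have hst' : 0 ≤ (t : ℝ) - s := sub_nonneg.2 hst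
  obtain ⟨L, hL, hlim, hbound⟩ := (dyadicScheme_grid hst).exists_limit hm hA hα hb hst'
    (by norm_num) (by norm_num) ht
  have hlim' := hφ.tendsto_partitionSum hm hA hα hb hst ht
  have hmem := (hφ.memLp t ht).sub (hφ.memLp s (hst.trans ht))
  have hae : φ t - φ s =ᵐ[P] L := eLpNorm_sub_eq_zero_of_tendsto (one_le_ofReal hm)
    (fun n => (hA.memLp_partitionSum ((dyadicScheme_grid hst).mono n)
      (((dyadicScheme_grid hst).right n).trans_le ht)).1) hmem.1 hL.1 hlim' hlim
  rw [eLpNorm_congr_ae hae]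
  refine hbound.trans_eq ?_
  rw [← Real.rpow_add' hst' (by linarith), sub_add_cancel]
  unfold incrementConst
  ring

theorem IsSewing.sub (hm : 2 ≤ m) {A B : ℝ≥0 → ℝ≥0 → Ω → ℝ}
    {φ ψ : ℝ≥0 → Ω → ℝ} (hA : ∀ s t, s ≤ t → t ≤ T → Integrable (A s t) P)
    (hB : ∀ s t, s ≤ t → t ≤ T → Integrable (B s t) P)
    (hφ : IsSewing P 𝓕 m T A φ) (hψ : IsSewing P 𝓕 m T B ψ) :
    IsSewing P 𝓕 m T (A - B) (φ - ψ) := by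
  have hp := one_le_ofReal hm
  obtain ⟨ε₁, hε₁, K₁, hK₁⟩ := hφ.bounds
  obtain ⟨ε₂, hε₂, K₂, hK₂⟩ := hψ.bounds
  set ε := min ε₁ ε₂ with hε
  have hε0 : 0 < ε := lt_min hε₁ hε₂
  -- Both pairs of bounds are brought to the smaller exponent `ε`, at the price of a power of `T +
  -- 1`.
  have hpow : ∀ (e β x : ℝ), 0 < β → 0 ≤ x → x ≤ T → ε ≤ e → 
      ENNReal.ofReal (x ^ (β + e)) ≤ ENNReal.ofReal ((T + 1 : ℝ) ^ (e - ε))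
        * ENNReal.ofReal (x ^ (β + ε)) := by
    intro e β x hβ hx hxT he
    rw [← ENNReal.ofReal_mul (by positivity)]
    refine ENNReal.ofReal_le_ofReal ?_
    rcases hx.eq_or_lt with rfl | hx0
    · rw [Real.zero_rpow (by linarith)]
      positivity
    · rw [show β + e = (e - ε) + (β + ε) by ring, Real.rpow_add hx0]
      gcongr
      · linarith
  set K : ℝ≥0∞ := K₁ * ENNReal.ofReal ((T + 1 : ℝ) ^ (ε₁ - ε))
    + K₂ * ENNReal.ofReal ((T + 1 : ℝ) ^ (ε₂ - ε)) with hK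
  have hKtop : K ≠ ∞ := by finiteness
  refine ⟨?_, fun t ht => (hφ.adapted t ht).sub (hψ.adapted t ht),
    fun t ht => (hφ.memLp t ht).sub (hψ.memLp t ht), ε, hε0, K.toNNReal, ?_⟩
  · filter_upwards [hφ.zero, hψ.zero] with ω h1 h2
    simp [h1, h2]
  · intro s t hst ht
    rw [ENNReal.coe_toNNReal hKtop]
    have hst' : (s : ℝ) ≤ t := hst
    have ht' : (t : ℝ) ≤ T := ht
    have hx : 0 ≤ (t : ℝ) - s := by linarith
    have hxT : (t : ℝ) - s ≤ T := by linarith [s.coe_nonneg]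
    have hs := hst.trans ht
    obtain ⟨a1, a2⟩ := hK₁ s t hst ht
    obtain ⟨b1, b2⟩ := hK₂ s t hst ht
    have mφ := (hφ.memLp t ht).sub (hφ.memLp s hs)
    have mψ := (hψ.memLp t ht).sub (hψ.memLp s hs)
    constructor
    · have e : (fun ω => (φ - ψ) t ω - (φ - ψ) s ω) = (φ t - φ s) - (ψ t - ψ s) := by
        ext ω
        simp only [Pi.sub_apply]
        ring
      rw [e, hK, add_mul, mul_assoc, mul_assoc]
      refine (MeasureTheory.eLpNorm_sub_le mφ.1 mψ.1 hp).trans (add_le_add (a1.trans ?_) (b1.trans ?_))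
      · gcongr
        exact hpow ε₁ (1 / 2) _ (by norm_num) hx hxT (min_le_left _ _)
      · gcongr
        exact hpow ε₂ (1 / 2) _ (by norm_num) hx hxT (min_le_right _ _)
    · have e : (fun ω => (φ - ψ) t ω - (φ - ψ) s ω - (A - B) s t ω)
          = (φ t - φ s - A s t) - (ψ t - ψ s - B s t) := by
        ext ω
        simp only [Pi.sub_apply]
        ring
      have h1 := condExp_sub ((mφ.integrable hp).sub (hA s t hst ht))
        ((mψ.integrable hp).sub (hB s t hst ht)) (𝓕 s)
      rw [e, eLpNorm_congr_ae h1, hK, add_mul, mul_assoc, mul_assoc]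
      refine (MeasureTheory.eLpNorm_sub_le integrable_condExp.aestronglyMeasurable
        integrable_condExp.aestronglyMeasurable hp).trans (add_le_add (a2.trans ?_) (b2.trans ?_))
      · gcongr
        exact hpow ε₁ 1 _ (by norm_num) hx hxT (min_le_left _ _)
      · gcongr
        exact hpow ε₂ 1 _ (by norm_num) hx hxT (min_le_right _ _)

theorem IsGerm.sub (hm : 2 ≤ m) {A B : ℝ≥0 → ℝ≥0 → Ω → ℝ}
    (hA : IsGerm P 𝓕 m T A) (hB : IsGerm P 𝓕 m T B) : IsGerm P 𝓕 m T (A - B) := by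
  have hp := one_le_ofReal hm
  refine ⟨fun s t hst ht => (hA.stronglyMeasurable s t hst ht).sub (hB.stronglyMeasurable s t hst ht),
    fun s t hst ht => (hA.memLp s t hst ht).sub (hB.memLp s t hst ht), fun s u t hsu hut ht => ?_⟩
  have h1 := condExp_sub ((hA.memLp u t hut ht).integrable hp)
    ((hB.memLp u t hut ht).integrable hp) (𝓕 s)
  filter_upwards [h1, hA.condExp_eq s u t hsu hut ht, hB.condExp_eq s u t hsu hut ht]
    with ω h1 h2 h3
  have : P[(A - B) u t | 𝓕 s] ω = P[A u t - B u t | 𝓕 s] ω := rfl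
  rw [this, h1]
  simp only [Pi.sub_apply, h2, h3]
  ring

/-- The difference of two sewings is a sewing of the zero germ, whose increments vanish by the bound
with `Γ = 0`; the exponent `1` is an arbitrary one above `1/2`. -/
theorem IsSewing.ae_eq (hm : 2 ≤ m) (hA : IsGerm P 𝓕 m T A) {φ ψ : ℝ≥0 → Ω → ℝ}
    (hφ : IsSewing P 𝓕 m T A φ) (hψ : IsSewing P 𝓕 m T A ψ) {t : ℝ≥0} (ht : t ≤ T) :
    ψ t =ᵐ[P] φ t := by
  have hint := fun s t (h1 : s ≤ t) (h2 : t ≤ T) => hA.integrable hm h1 h2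
  have hsew := hψ.sub hm hint hint hφ
  have hger := hA.sub hm hA
  have hb : GermBound P m T (A - A) 0 1 := by
    intro s t _ _
    simp
  have h := hsew.eLpNorm_sub_le hm hger (by norm_num) hb (zero_le) ht
  simp only [ENNReal.coe_zero, mul_zero, zero_mul] at h
  have hmem := ((hsew.memLp t ht).sub (hsew.memLp 0 (zero_le))).1
  have h0 := (eLpNorm_eq_zero_iff hmem (by simp; linarith)).1 (le_antisymm h bot_le)
  filter_upwards [h0, hφ.zero, hψ.zero] with ω h1 h2 h3
  simp only [Pi.sub_apply, Pi.zero_apply] at h1 h2 h3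
  linarith

end Sewing

/-! ### Carathéodory functions -/

section Caratheodory

variable {α : Type*} [MeasurableSpace α] {μ : Measure α}

/-- Approximate `f` pointwise by simple functions, for which the composition is a finite sum of
measurable pieces. It serves to insert `f r` into the propagator at a fixed point of space, without
separability of `𝓗`. -/
theorem aemeasurable_comp_of_caratheodory {E : Type*} [TopologicalSpace E]
    [TopologicalSpace.PseudoMetrizableSpace E] {F : α → E → ℝ}
    (hF : ∀ h, AEMeasurable (fun r => F r h) μ) (hc : ∀ᵐ r ∂μ, Continuous (F r)) {f : α → E}
    (hf : AEStronglyMeasurable f μ) : AEMeasurable (fun r => F r (f r)) μ := by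
  classical
  have hg := hf.stronglyMeasurable_mk
  have hae : (fun r => F r (f r)) =ᵐ[μ] fun r => F r (hf.mk f r) := by
    filter_upwards [hf.ae_eq_mk] with r hr
    rw [hr]
  refine AEMeasurable.congr ?_ hae.symm
  refine aemeasurable_of_tendsto_metrizable_ae atTop (f := fun n r => F r (hg.approx n r)) ?_ ?_
  · intro n
    have e : (fun r => F r (hg.approx n r)) = fun r => ∑ h ∈ (hg.approx n).range,
        ((hg.approx n) ⁻¹' {h}).indicator (fun r => F r h) r := by
      ext r
      rw [Finset.sum_eq_single (hg.approx n r)]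
      · simp
      · intro h _ hne
        exact Set.indicator_of_notMem (fun hr => hne hr.symm) _
      · intro hr
        exact absurd ((hg.approx n).mem_range_self r) hr
    rw [e]
    exact Finset.aemeasurable_fun_sum _ fun h _ =>
      (hF h).indicator ((hg.approx n).measurableSet_fiber h)
  · filter_upwards [hc] with r hr
    exact (hr.tendsto _).comp (hg.tendsto_approx r)

/-- The null set where `F · x` differs from a measurable version depends on `x`. Continuity allows
handling only a countable dense set of points, hence one null set, outside of which `F` is
unchanged. -/
theorem exists_stronglyMeasurable_of_caratheodory {E : Type*} [TopologicalSpace E]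
    [TopologicalSpace.MetrizableSpace E] [SecondCountableTopology E] [MeasurableSpace E]
    [BorelSpace E] {F : α → E → ℝ} (hF : ∀ x, AEMeasurable (fun r => F r x) μ)
    (hc : ∀ᵐ r ∂μ, Continuous (F r)) :
    ∃ F' : E → α → ℝ, StronglyMeasurable (Function.uncurry F') ∧
      ∀ᵐ r ∂μ, ∀ x, F' x r = F r x := by
  obtain ⟨D, hDc, hDd⟩ := TopologicalSpace.exists_countable_dense E
  have hall : ∀ᵐ r ∂μ, Continuous (F r) ∧ ∀ x ∈ D, F r x = (hF x).mk _ r := by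
    have h1 : ∀ᵐ r ∂μ, ∀ x ∈ D, F r x = (hF x).mk _ r :=
      (ae_ball_iff hDc).2 fun x _ => (hF x).ae_eq_mk
    filter_upwards [hc, h1] with r a b using ⟨a, b⟩
  obtain ⟨N, hNsub, hNm, hN0⟩ := exists_measurable_superset_of_null (ae_iff.1 hall)
  have hgood : ∀ r ∉ N, Continuous (F r) ∧ ∀ x ∈ D, F r x = (hF x).mk _ r := by
    intro r hr
    by_contra hcon
    exact hr (hNsub hcon)
  set F' : E → α → ℝ := fun x => Nᶜ.indicator (fun r => F r x) with hF'
  have hcont : ∀ r, Continuous fun x => F' x r := by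
    intro r
    by_cases hr : r ∈ N
    · simp only [hF', Set.indicator_of_notMem (Set.notMem_compl_iff.2 hr)]
      exact continuous_const
    · simp only [hF', Set.indicator_of_mem (Set.mem_compl hr)]
      exact (hgood r hr).1
  have hmD : ∀ x ∈ D, Measurable (F' x) := by
    intro x hx
    have e : F' x = Nᶜ.indicator ((hF x).mk _) := by
      ext r
      by_cases hr : r ∈ N
      · simp [hF', hr]
      · simp [hF', hr, (hgood r hr).2 x hx]
    rw [e]
    exact (hF x).measurable_mk.indicator hNm.compl
  have hm : ∀ x, StronglyMeasurable (F' x) := by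
    intro x
    obtain ⟨u, huD, hu⟩ := mem_closure_iff_seq_limit.1 (hDd x)
    refine (measurable_of_tendsto_metrizable (fun n => hmD _ (huD n)) ?_).stronglyMeasurable
    exact tendsto_pi_nhds.2 fun r => ((hcont r).tendsto x).comp hu
  refine ⟨F', stronglyMeasurable_uncurry_of_continuous_of_stronglyMeasurable hcont hm, ?_⟩
  filter_upwards [measure_eq_zero_iff_ae_notMem.1 hN0] with r hr x
  simp [hF', hr]

theorem integral_integral_swap_of_caratheodory {E : Type*} [TopologicalSpace E]
    [TopologicalSpace.MetrizableSpace E] [SecondCountableTopology E] [MeasurableSpace E]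
    [BorelSpace E] [SFinite μ] {Ω : Type*} {mΩ : MeasurableSpace Ω} {P : Measure Ω}
    [IsFiniteMeasure P] {F : α → E → ℝ} (hF : ∀ x, AEMeasurable (fun r => F r x) μ)
    (hc : ∀ᵐ r ∂μ, Continuous (F r)) {b : α → ℝ} (hb : Integrable b μ)
    (hFb : ∀ᵐ r ∂μ, ∀ x, |F r x| ≤ b r) {X : Ω → E} (hX : Measurable X) :
    ∫ ω, ∫ r, F r (X ω) ∂μ ∂P = ∫ r, ∫ ω, F r (X ω) ∂P ∂μ := by
  obtain ⟨F', hF'm, hF'⟩ := exists_stronglyMeasurable_of_caratheodory hF hc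
  have e1 : ∀ ω, ∫ r, F r (X ω) ∂μ = ∫ r, F' (X ω) r ∂μ := fun ω =>
    integral_congr_ae (by filter_upwards [hF'] with r hr using (hr _).symm)
  have e2 : ∫ r, ∫ ω, F r (X ω) ∂P ∂μ = ∫ r, ∫ ω, F' (X ω) r ∂P ∂μ :=
    integral_congr_ae (by filter_upwards [hF'] with r hr; simp only [hr])
  simp_rw [e1, e2]
  refine integral_integral_swap ?_
  refine (hb.comp_snd P).mono' ?_ ?_
  · exact (hF'm.comp_measurable ((hX.comp measurable_fst).prodMk measurable_snd)
      ).aestronglyMeasurable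
  · have h1 : ∀ᵐ r ∂μ, ∀ x, |F' x r| ≤ b r := by
      filter_upwards [hF', hFb] with r h1 h2 x
      rw [h1]
      exact h2 x
    filter_upwards [Measure.quasiMeasurePreserving_snd.ae h1] with p hp
    exact hp (X p.1)

end Caratheodory

/-! ### The singular kernel `(r - s) ^ γ` -/

/-- The constant in Hölder's inequality for `∫ ‖f_r‖ (r - s) ^ γ dr`. -/
def holderConst (q : ℝ≥0∞) (γ : ℝ) : ℝ≥0∞ :=
  ENNReal.ofReal ((1 / (γ / (1 - (q⁻¹).toReal) + 1)) ^ (1 - (q⁻¹).toReal))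

/-- The germ integrates over a closed interval, but the propagator is controlled only for `s < r`;
the left endpoint is negligible. -/
theorem ae_Icc_lt (s t : ℝ) : ∀ᵐ r ∂(volume.restrict (Set.Icc s t)), s < r ∧ r ≤ t := by
  rw [← restrict_Ioc_eq_restrict_Icc]
  exact ae_restrict_mem measurableSet_Ioc

theorem lintegral_enorm_mul_rpow_le {E : Type*} [NormedAddCommGroup E] [NormedSpace ℝ E]
    {q : ℝ≥0∞} (hq : 2 < q) {γ : ℝ} (hγ : γ - (q⁻¹).toReal > -1) {f : ℝ → E} {s t : ℝ}
    (hst : s ≤ t) (hf : AEStronglyMeasurable f (volume.restrict (Set.Icc s t))) :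
    ∫⁻ r in Set.Icc s t, ‖f r‖ₑ * ENNReal.ofReal ((r - s) ^ γ)
      ≤ holderConst q γ * eLpNorm f q (volume.restrict (Set.Icc s t))
        * ENNReal.ofReal ((t - s) ^ (1 + γ - (q⁻¹).toReal)) := by
  have hq1 : 1 ≤ q := le_trans (by norm_num) hq.le
  have hqinv : q⁻¹ ≤ 2⁻¹ := ENNReal.inv_le_inv.2 hq.le
  have hqi : (q⁻¹).toReal ≤ 1 / 2 := by
    have := ENNReal.toReal_mono (by simp) hqinv
    simpa using this
  have hqi0 : 0 ≤ (q⁻¹).toReal := ENNReal.toReal_nonneg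
  -- `a` is the inverse of the conjugate exponent `q'`, and `e = γ / a` below is `γ q'`. The
  -- condition on `γ` says `e > -1`, integrability of the kernel to the power `q'`; `q = ∞` is
  -- included.
  set a := 1 - (q⁻¹).toReal with ha
  have ha0 : 0 < a := by linarith
  set q' : ℝ≥0∞ := (1 - q⁻¹)⁻¹ with hq'
  have : ENNReal.HolderConjugate q q' := ENNReal.HolderConjugate.inv_one_sub_inv' hq1
  have hhold : ENNReal.HolderTriple q' q 1 := ENNReal.HolderTriple.symm
  have hle1 : q⁻¹ ≤ 1 := hqinv.trans (by norm_num)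
  have hq'r : q'.toReal = a⁻¹ := by
    rw [hq', ENNReal.toReal_inv, ENNReal.toReal_sub_of_le hle1 (by simp), ENNReal.toReal_one]
  have hsub0 : 1 - q⁻¹ ≠ 0 := by
    refine (tsub_pos_of_lt (hqinv.trans_lt ?_)).ne'
    rw [ENNReal.inv_lt_one]
    norm_num
  have hq'top : q' ≠ ∞ := ENNReal.inv_ne_top.2 hsub0
  have hq'0 : q' ≠ 0 := ENNReal.inv_ne_zero.2 (by finiteness)
  set e := γ / a with he
  have he1 : -1 < e := by
    rw [he, lt_div_iff₀ ha0]
    linarith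
  have hφm : AEStronglyMeasurable (fun r : ℝ => (r - s) ^ γ) (volume.restrict (Set.Icc s t)) := by
    have : Measurable fun r : ℝ => (r - s) ^ γ := by fun_prop
    exact this.aestronglyMeasurable
  have hint : ∫ r in Set.Icc s t, (r - s) ^ e = (t - s) ^ (e + 1) / (e + 1) := by
    rw [integral_Icc_eq_integral_Ioc, ← intervalIntegral.integral_of_le hst,
      intervalIntegral.integral_comp_sub_right (fun x => x ^ e) s, integral_rpow (Or.inl he1),
      sub_self, Real.zero_rpow (by linarith), sub_zero]
  have hIon : IntegrableOn (fun r : ℝ => (r - s) ^ e) (Set.Icc s t) := by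
    rw [integrableOn_Icc_iff_integrableOn_Ioc, ← intervalIntegrable_iff_integrableOn_Ioc_of_le hst]
    have := (intervalIntegral.intervalIntegrable_rpow' (a := 0) (b := t - s) he1).comp_sub_right s
    simpa using this
  have hts : 0 ≤ t - s := by linarith
  have hφ : eLpNorm (fun r : ℝ => (r - s) ^ γ) q' (volume.restrict (Set.Icc s t))
      = holderConst q γ * ENNReal.ofReal ((t - s) ^ (1 + γ - (q⁻¹).toReal)) := by
    rw [eLpNorm_eq_lintegral_rpow_enorm_toReal hq'0 hq'top, hq'r, one_div, inv_inv]
    have h1 : ∫⁻ r in Set.Icc s t, ‖(r - s) ^ γ‖ₑ ^ a⁻¹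
        = ENNReal.ofReal ((t - s) ^ (e + 1) / (e + 1)) := by
      rw [← hint, ofReal_integral_eq_lintegral_ofReal hIon]
      · refine lintegral_congr_ae ?_
        filter_upwards [ae_Icc_lt s t] with r hr
        have hr0 : 0 ≤ r - s := by linarith [hr.1]
        rw [Real.enorm_eq_ofReal (by positivity), ENNReal.ofReal_rpow_of_nonneg (by positivity)
          (by positivity), ← Real.rpow_mul hr0, he, div_eq_mul_inv]
      · filter_upwards [ae_Icc_lt s t] with r hr
        have hr0 : 0 ≤ r - s := by linarith [hr.1]
        exact Real.rpow_nonneg hr0 _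
    have he1' : 0 < e + 1 := by linarith
    rw [h1, ENNReal.ofReal_rpow_of_nonneg (by positivity) ha0.le, holderConst, ← ha, ← he,
      ← ENNReal.ofReal_mul (by positivity)]
    congr 1
    rw [div_eq_mul_one_div, Real.mul_rpow (by positivity) (by positivity), mul_comm,
      ← Real.rpow_mul hts]
    congr 2
    have h2 : (e + 1) * a = γ + a := by
      rw [he]
      field_simp
    linarith
  have key := eLpNorm_smul_le_mul_eLpNorm (p := q') (q := q) (r := 1) hf hφm
  rw [hφ, eLpNorm_one_eq_lintegral_enorm] at key
  calc _ = ∫⁻ r in Set.Icc s t, ‖((fun r : ℝ => (r - s) ^ γ) • f) r‖ₑ := by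
        refine lintegral_congr_ae ?_
        filter_upwards [ae_Icc_lt s t] with r hr
        have hr0 : 0 ≤ r - s := by linarith [hr.1]
        simp only [Pi.smul_apply', enorm_smul]
        rw [Real.enorm_eq_ofReal (by positivity), mul_comm]
    _ ≤ _ := key
    _ = _ := by ring

/-! ### Distributions which are bounded continuous functions -/

section Analytic

variable {d : ℕ} {𝓗 : Type*} [NormedAddCommGroup 𝓗] [NormedSpace ℝ 𝓗] {H : DistributionSpace d 𝓗}

theorem integrable_bcf_mul_schwartz (b : Rd d →ᵇ ℝ) (φ : 𝓢(Rd d, ℝ)) :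
    Integrable (fun x => b x * φ x) := by
  refine (φ.integrable (μ := volume)).bdd_mul (c := ‖b‖) b.continuous.aestronglyMeasurable ?_
  exact Eventually.of_forall fun x => b.norm_coe_le_norm x

theorem DistributionSpace.Represents.sub {h h' : 𝓗} {b b' : Rd d →ᵇ ℝ} (hb : H.Represents h b)
    (hb' : H.Represents h' b') : H.Represents (h - h') (b - b') := by
  intro φ
  rw [map_sub, sub_apply, hb φ, hb' φ,
    ← integral_sub (integrable_bcf_mul_schwartz b φ) (integrable_bcf_mul_schwartz b' φ)]
  simp [sub_mul]

theorem DistributionSpace.Represents.smul {h : 𝓗} {b : Rd d →ᵇ ℝ} (hb : H.Represents h b) (c : ℝ) :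
    H.Represents (c • h) (c • b) := by
  intro φ
  rw [map_smul, smul_apply, hb φ, smul_eq_mul, ← integral_const_mul]
  simp [mul_assoc]

theorem DistributionSpace.IsBoundedContinuous.sub {h h' : 𝓗} (hb : H.IsBoundedContinuous h)
    (hb' : H.IsBoundedContinuous h') : H.IsBoundedContinuous (h - h') :=
  ⟨_, hb.choose_spec.sub hb'.choose_spec⟩

theorem DistributionSpace.eval_sub {h h' : 𝓗} (hb : H.IsBoundedContinuous h)
    (hb' : H.IsBoundedContinuous h') (x : Rd d) : H.eval (h - h') x = H.eval h x - H.eval h' x := by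
  obtain ⟨b, hb⟩ := hb
  obtain ⟨b', hb'⟩ := hb'
  rw [hb.eval_eq, hb'.eval_eq, (hb.sub hb').eval_eq]
  rfl

theorem DistributionSpace.eval_smul {h : 𝓗} (hb : H.IsBoundedContinuous h) (c : ℝ) (x : Rd d) :
    H.eval (c • h) x = c * H.eval h x := by
  obtain ⟨b, hb⟩ := hb
  rw [hb.eval_eq, (hb.smul c).eval_eq]
  rfl

theorem DistributionSpace.eval_zero (x : Rd d) : H.eval 0 x = 0 := by
  have : H.Represents 0 0 := fun φ => by simp
  rw [this.eval_eq]
  rfl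

theorem DistributionSpace.continuous_eval {h : 𝓗} (hb : H.IsBoundedContinuous h) :
    Continuous (H.eval h) := by
  obtain ⟨b, hb⟩ := hb
  have : H.eval h = b := funext hb.eval_eq
  rw [this]
  exact b.continuous

/-- The infimum is attained, since for `h ≠ 0` one may divide by a finite nonzero factor. It remains
valid for infinite norm, which matters for the difference of two propagators. -/
theorem enorm_eval_le_propagatorNorm {T : ℝ≥0} {ν : ℝ} {V : ℝ → ℝ → 𝓗 →L[ℝ] 𝓗} (h : 𝓗) {s t : ℝ}
    (hs : 0 ≤ s) (hst : s < t) (ht : t ≤ T) (x : Rd d) :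
    ‖H.eval (V s t h) x‖ₑ
      ≤ propagatorNorm H T ν V * (‖h‖ₑ * ENNReal.ofReal ((t - s) ^ (ν / 2))) := by
  rcases eq_or_ne h 0 with rfl | hh
  · simp [DistributionSpace.eval_zero]
  · have hpos : 0 < (t - s) ^ (ν / 2) := Real.rpow_pos_of_pos (by linarith) _
    have ha0 : ‖h‖ₑ * ENNReal.ofReal ((t - s) ^ (ν / 2)) ≠ 0 :=
      mul_ne_zero (by simpa using hh) (by simpa using hpos)
    have hat : ‖h‖ₑ * ENNReal.ofReal ((t - s) ^ (ν / 2)) ≠ ∞ := by finiteness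
    rw [← ENNReal.div_le_iff ha0 hat]
    refine le_sInf fun M hM => ?_
    rw [ENNReal.div_le_iff ha0 hat, Real.enorm_eq_ofReal_abs, ← mul_assoc]
    exact hM h s t hs hst ht x

/-- Monotonicity makes the modulus Borel, so that its composition with `‖X - Y‖` is measurable. -/
theorem monotone_propagatorModulus (T : ℝ≥0) (ν₁ : ℝ) (U : ℝ → ℝ → 𝓗 →L[ℝ] 𝓗) :
    Monotone (propagatorModulus H T ν₁ U) := by
  intro δ δ' hδ
  unfold propagatorModulus
  gcongr with h h1 s t h2 h3 h4 x y
  exact iSup_const_mono fun h => h.trans hδ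

theorem enorm_eval_sub_le_propagatorModulus {T : ℝ≥0} {ν₁ : ℝ} {U : ℝ → ℝ → 𝓗 →L[ℝ] 𝓗} (h : 𝓗)
    {s t : ℝ} (hs : 0 ≤ s) (hst : s < t) (ht : t ≤ T) (hb : H.IsBoundedContinuous (U s t h))
    (x y : Rd d) : ‖H.eval (U s t h) x - H.eval (U s t h) y‖ₑ
      ≤ propagatorModulus H T ν₁ U ‖x - y‖ * (‖h‖ₑ * ENNReal.ofReal ((t - s) ^ (ν₁ / 2))) := by
  rcases eq_or_ne h 0 with rfl | hh
  · simp [DistributionSpace.eval_zero]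
  · have hpos : 0 < (t - s) ^ (ν₁ / 2) := Real.rpow_pos_of_pos (by linarith) _
    have hn : 0 < ‖h‖ := norm_pos_iff.2 hh
    have hle : ENNReal.ofReal (|H.eval (U s t (‖h‖⁻¹ • h)) x - H.eval (U s t (‖h‖⁻¹ • h)) y|
        / (t - s) ^ (ν₁ / 2)) ≤ propagatorModulus H T ν₁ U ‖x - y‖ := by
      unfold propagatorModulus
      have h1 : ‖‖h‖⁻¹ • h‖ ≤ 1 := by
        rw [norm_smul, norm_inv, norm_norm, inv_mul_cancel₀ hn.ne']
      exact le_iSup₂_of_le (‖h‖⁻¹ • h) h1 (le_iSup₂_of_le s t (le_iSup₂_of_le hs hst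
        (le_iSup₂_of_le ht x (le_iSup₂_of_le y le_rfl le_rfl))))
    rw [map_smul, DistributionSpace.eval_smul hb, DistributionSpace.eval_smul hb, ← mul_sub, abs_mul,
      abs_of_pos (inv_pos.2 hn)] at hle
    calc ‖H.eval (U s t h) x - H.eval (U s t h) y‖ₑ
        = ENNReal.ofReal (‖h‖⁻¹ * |H.eval (U s t h) x - H.eval (U s t h) y|
            / (t - s) ^ (ν₁ / 2)) * (‖h‖ₑ * ENNReal.ofReal ((t - s) ^ (ν₁ / 2))) := by
          rw [← ofReal_norm h, ← ENNReal.ofReal_mul (norm_nonneg _),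
            ← ENNReal.ofReal_mul (by positivity), Real.enorm_eq_ofReal_abs]
          congr 1
          field_simp
      _ ≤ _ := by gcongr

end Analytic

/-! ### The germ `∫ U_{s,r} f_r (X_s) dr` -/

section Kernel

variable {d : ℕ} {𝓗 : Type*} [NormedAddCommGroup 𝓗] [NormedSpace ℝ 𝓗] {H : DistributionSpace d 𝓗}
  {Ω : Type*} {mΩ : MeasurableSpace Ω} {P : Measure Ω} {𝓕 : Filtration ℝ≥0 mΩ} {T : ℝ≥0} {ν : ℝ}
  {X : ℝ≥0 → Ω → Rd d} {U : ℝ → ℝ → 𝓗 →L[ℝ] 𝓗} {f : ℝ → 𝓗}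

theorem PropagatorCondition.propagatorNorm_ne_top (hU : PropagatorCondition P 𝓕 H T ν X U) :
    propagatorNorm H T ν U ≠ ∞ := by
  obtain ⟨K, hK0, hK⟩ := hU.bound
  refine ne_top_of_le_ne_top (ENNReal.ofReal_ne_top (r := K)) (sInf_le ?_)
  intro h s t hs hst ht x
  rw [← ofReal_norm, ← ENNReal.ofReal_mul hK0, ← ENNReal.ofReal_mul (by positivity)]
  exact ENNReal.ofReal_le_ofReal (hK h s t hs hst ht x)

theorem PropagatorCondition.continuous_in_space (hU : PropagatorCondition P 𝓕 H T ν X U) {s u t : ℝ}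
    (hs : 0 ≤ s) (hsu : s ≤ u) (ht : t ≤ T) (f : ℝ → 𝓗) :
    ∀ᵐ r ∂(volume.restrict (Set.Icc u t)), Continuous fun x => H.eval (U s r (f r)) x := by
  filter_upwards [ae_Icc_lt u t] with r hr
  exact DistributionSpace.continuous_eval
    (hU.isBoundedContinuous _ _ _ hs (by linarith [hr.1]) (hr.2.trans ht))

theorem PropagatorCondition.continuous_in_datum (hU : PropagatorCondition P 𝓕 H T ν X U) {s t : ℝ}
    (hs : 0 ≤ s) (hst : s < t) (ht : t ≤ T) (x : Rd d) :
    Continuous fun h => H.eval (U s t h) x := by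
  obtain ⟨K, hK0, hK⟩ := hU.bound
  have hpos : 0 ≤ (t - s) ^ (ν / 2) := Real.rpow_nonneg (by linarith) _
  refine (LipschitzWith.of_dist_le_mul
    (K := (⟨K * (t - s) ^ (ν / 2), by positivity⟩ : ℝ≥0)) fun h h' => ?_).continuous
  rw [Real.dist_eq, ← DistributionSpace.eval_sub (hU.isBoundedContinuous _ _ _ hs hst ht)
    (hU.isBoundedContinuous _ _ _ hs hst ht), ← map_sub, dist_eq_norm]
  refine (hK (h - h') s t hs hst ht x).trans_eq ?_
  exact mul_right_comm _ _ _

theorem PropagatorCondition.aemeasurable_eval (hU : PropagatorCondition P 𝓕 H T ν X U) {s u t : ℝ}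
    (hs : 0 ≤ s) (hsu : s ≤ u) (ht : t ≤ T)
    (hf : AEStronglyMeasurable f (volume.restrict (Set.Icc (0 : ℝ) T))) (x : Rd d) :
    AEMeasurable (fun r => H.eval (U s r (f r)) x) (volume.restrict (Set.Icc u t)) := by
  refine aemeasurable_comp_of_caratheodory (F := fun r h => H.eval (U s r h) x)
    (fun h => (hU.measurable s x h hs).mono_measure
      (Measure.restrict_mono (Set.Icc_subset_Icc hsu ht) le_rfl)) ?_
    (hf.mono_measure (Measure.restrict_mono (Set.Icc_subset_Icc (hs.trans hsu) ht) le_rfl))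
  filter_upwards [ae_Icc_lt u t] with r hr
  exact hU.continuous_in_datum hs (by linarith [hr.1]) (hr.2.trans ht) x

theorem lintegral_kernel_le {q : ℝ≥0∞} (hq : 2 < q) (hνq : ν / 2 - (q⁻¹).toReal > -(1 / 2))
    {s t : ℝ} (hs : 0 ≤ s) (hst : s ≤ t) (ht : t ≤ T)
    (hf : AEStronglyMeasurable f (volume.restrict (Set.Icc (0 : ℝ) T))) :
    ∫⁻ r in Set.Icc s t, ‖f r‖ₑ * ENNReal.ofReal ((r - s) ^ (ν / 2))
      ≤ holderConst q (ν / 2) * eLpNorm f q (volume.restrict (Set.Icc (0 : ℝ) T))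
        * ENNReal.ofReal ((t - s) ^ (1 + ν / 2 - (q⁻¹).toReal)) := by
  have hle := Measure.restrict_mono (μ := (volume : Measure ℝ)) (Set.Icc_subset_Icc hs ht) le_rfl
  refine (lintegral_enorm_mul_rpow_le hq (by linarith) hst (hf.mono_measure hle)).trans ?_
  gcongr

theorem integrable_kernel {q : ℝ≥0∞} (hq : 2 < q) (hνq : ν / 2 - (q⁻¹).toReal > -(1 / 2))
    {s u t : ℝ} (hs : 0 ≤ s) (hst : s ≤ t) (hsu : s ≤ u) (ht : t ≤ T)
    (hf : MemLp f q (volume.restrict (Set.Icc (0 : ℝ) T))) (K : ℝ) :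
    Integrable (fun r => K * ‖f r‖ * (r - s) ^ (ν / 2)) (volume.restrict (Set.Icc u t)) := by
  have hle := Measure.restrict_mono (μ := (volume : Measure ℝ)) (Set.Icc_subset_Icc hs ht) le_rfl
  suffices h : Integrable (fun r => ‖f r‖ * (r - s) ^ (ν / 2)) (volume.restrict (Set.Icc s t)) by
    have := (h.const_mul K).mono_measure
      (Measure.restrict_mono (Set.Icc_subset_Icc_left hsu) le_rfl)
    simpa only [mul_assoc] using this
  refine ⟨(hf.1.mono_measure hle).norm.mul ?_, ?_⟩
  · have : Measurable fun r : ℝ => (r - s) ^ (ν / 2) := by fun_prop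
    exact this.aestronglyMeasurable
  · have h1 := lintegral_kernel_le (T := T) hq hνq hs hst ht hf.1
    have h2 := hf.eLpNorm_ne_top
    have h3 : holderConst q (ν / 2) ≠ ∞ := ENNReal.ofReal_ne_top
    refine lt_of_le_of_lt ?_ (h1.trans_lt (by finiteness))
    refine lintegral_mono_ae ?_
    filter_upwards [ae_Icc_lt s t] with r hr
    have : 0 ≤ (r - s) ^ (ν / 2) := Real.rpow_nonneg (by linarith [hr.1]) _
    rw [enorm_mul, Real.enorm_eq_ofReal this, enorm_norm]

/-- The Bochner integrability of the integrand of the germ, at a fixed point of space. -/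
theorem PropagatorCondition.integrable_eval (hU : PropagatorCondition P 𝓕 H T ν X U) {q : ℝ≥0∞}
    (hq : 2 < q) (hνq : ν / 2 - (q⁻¹).toReal > -(1 / 2))
    (hf : MemLp f q (volume.restrict (Set.Icc (0 : ℝ) T))) {s u t : ℝ}
    (hs : 0 ≤ s) (hsu : s ≤ u) (hut : u ≤ t) (ht : t ≤ T) (x : Rd d) :
    Integrable (fun r => H.eval (U s r (f r)) x) (volume.restrict (Set.Icc u t)) := by
  obtain ⟨K, hK0, hK⟩ := hU.bound
  refine (integrable_kernel hq hνq hs (hsu.trans hut) hsu ht hf K).mono'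
    (hU.aemeasurable_eval hs hsu ht hf.1 x).aestronglyMeasurable ?_
  filter_upwards [ae_Icc_lt u t] with r hr
  exact hK (f r) s r hs (by linarith [hr.1]) (hr.2.trans ht) x

/-- Dominated convergence in the space variable. Continuity yields that the germ is a measurable
function of `X s`, hence `𝓕 s`-measurable. -/
theorem PropagatorCondition.continuous_integral (hU : PropagatorCondition P 𝓕 H T ν X U) {q : ℝ≥0∞}
    (hq : 2 < q) (hνq : ν / 2 - (q⁻¹).toReal > -(1 / 2))
    (hf : MemLp f q (volume.restrict (Set.Icc (0 : ℝ) T))) {s t : ℝ}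
    (hs : 0 ≤ s) (hst : s ≤ t) (ht : t ≤ T) :
    Continuous fun x => ∫ r in Set.Icc s t, H.eval (U s r (f r)) x := by
  obtain ⟨K, hK0, hK⟩ := hU.bound
  refine continuous_of_dominated
    (fun x => (hU.aemeasurable_eval hs le_rfl ht hf.1 x).aestronglyMeasurable) (fun x => ?_)
    (integrable_kernel hq hνq hs hst le_rfl ht hf K) (hU.continuous_in_space hs le_rfl ht f)
  filter_upwards [ae_Icc_lt s t] with r hr
  exact hK (f r) s r hs hr.1 (hr.2.trans ht) x

theorem PropagatorCondition.enorm_germ_le (hU : PropagatorCondition P 𝓕 H T ν X U) {q : ℝ≥0∞}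
    (hq : 2 < q) (hνq : ν / 2 - (q⁻¹).toReal > -(1 / 2))
    (hf : MemLp f q (volume.restrict (Set.Icc (0 : ℝ) T))) {s t : ℝ≥0} (hst : s ≤ t) (ht : t ≤ T)
    (ω : Ω) : ‖germ H X U f s t ω‖ₑ ≤
      propagatorNorm H T ν U * (holderConst q (ν / 2)
        * eLpNorm f q (volume.restrict (Set.Icc (0 : ℝ) T))
        * ENNReal.ofReal (((t : ℝ) - s) ^ (1 + ν / 2 - (q⁻¹).toReal))) := by
  unfold germ
  refine (enorm_integral_le_lintegral_enorm _).trans ?_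
  calc _ ≤ ∫⁻ r in Set.Icc (s : ℝ) t,
        propagatorNorm H T ν U * (‖f r‖ₑ * ENNReal.ofReal ((r - s) ^ (ν / 2))) := by
        refine lintegral_mono_ae ?_
        filter_upwards [ae_Icc_lt (s : ℝ) t] with r hr
        exact enorm_eval_le_propagatorNorm _ s.coe_nonneg hr.1
          (hr.2.trans (NNReal.coe_le_coe.2 ht)) _
    _ = propagatorNorm H T ν U
          * ∫⁻ r in Set.Icc (s : ℝ) t, ‖f r‖ₑ * ENNReal.ofReal ((r - s) ^ (ν / 2)) :=
        lintegral_const_mul' _ _ hU.propagatorNorm_ne_top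
    _ ≤ _ := by
        gcongr
        exact lintegral_kernel_le hq hνq s.coe_nonneg (NNReal.coe_le_coe.2 hst)
          (NNReal.coe_le_coe.2 ht) hf.1

theorem PropagatorCondition.germ_sub (hU : PropagatorCondition P 𝓕 H T ν X U) {q : ℝ≥0∞}
    (hq : 2 < q) (hνq : ν / 2 - (q⁻¹).toReal > -(1 / 2))
    (hf : MemLp f q (volume.restrict (Set.Icc (0 : ℝ) T))) {s u t : ℝ≥0} (hsu : s ≤ u) (hut : u ≤ t)
    (ht : t ≤ T) (ω : Ω) : germ H X U f s t ω - germ H X U f s u ω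
      = ∫ r in Set.Icc (u : ℝ) t, H.eval (U s r (f r)) (X s ω) := by
  have hsu' : (s : ℝ) ≤ u := hsu
  have hut' : (u : ℝ) ≤ t := hut
  have ht' : (t : ℝ) ≤ T := ht
  unfold germ
  have h1 := hU.integrable_eval hq hνq hf s.coe_nonneg le_rfl hsu' (hut'.trans ht') (X s ω)
  have h2 := hU.integrable_eval hq hνq hf s.coe_nonneg hsu' hut' ht' (X s ω)
  have hunion : Set.Icc (s : ℝ) t = Set.Icc (s : ℝ) u ∪ Set.Ioc (u : ℝ) t :=
    (Set.Icc_union_Ioc_eq_Icc hsu' hut').symm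
  rw [hunion, setIntegral_union _ measurableSet_Ioc h1
    (IntegrableOn.mono_set h2 Set.Ioc_subset_Icc_self), add_sub_cancel_left,
    integral_Icc_eq_integral_Ioc]
  exact Set.disjoint_left.2 fun r hr hr' => not_lt.2 hr.2 hr'.1

/-- The conditional expectation is tested on sets `B` of `𝓕 s`. Fubini brings the integral over `B`
inside the time integral, where the propagator identity replaces `U_{u,r} f_r (X_u)` by `U_{s,r} f_r
(X_s)` for each `r > u`. -/
theorem isGerm_germ [IsProbabilityMeasure P] {m : ℝ} (hm : 2 ≤ m) (hX : IsMarkovProcess P 𝓕 X)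
    (hU : PropagatorCondition P 𝓕 H T ν X U) {q : ℝ≥0∞}
    (hq : 2 < q) (hνq : ν / 2 - (q⁻¹).toReal > -(1 / 2))
    (hf : MemLp f q (volume.restrict (Set.Icc (0 : ℝ) T))) :
    IsGerm P 𝓕 m T (germ H X U f) := by
  have hsm : ∀ s t : ℝ≥0, s ≤ t → t ≤ T → StronglyMeasurable[𝓕 s] (germ H X U f s t) :=
    fun s t hst ht => (hU.continuous_integral hq hνq hf s.coe_nonneg (NNReal.coe_le_coe.2 hst)
      (NNReal.coe_le_coe.2 ht)).comp_stronglyMeasurable (hX.adapted s)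
  have hmem : ∀ s t : ℝ≥0, s ≤ t → t ≤ T → MemLp (germ H X U f s t) (ENNReal.ofReal m) P := by
    intro s t hst ht
    refine ⟨((hsm s t hst ht).mono (𝓕.le s)).aestronglyMeasurable, ?_⟩
    refine (eLpNorm_le_of_ae_enorm_bound
      (Eventually.of_forall (hU.enorm_germ_le hq hνq hf hst ht))).trans_lt ?_
    have h1 := hU.propagatorNorm_ne_top
    have h2 := hf.eLpNorm_ne_top
    have h3 : holderConst q (ν / 2) ≠ ∞ := ENNReal.ofReal_ne_top
    simp only [measure_univ, ENNReal.one_rpow, smul_eq_mul, mul_one]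
    finiteness
  refine ⟨hsm, hmem, fun s u t hsu hut ht => ?_⟩
  have hp := one_le_ofReal hm
  have hsT := (hsu.trans hut).trans ht
  have hsu' : (s : ℝ) ≤ u := hsu
  have hut' : (u : ℝ) ≤ t := hut
  have ht' : (t : ℝ) ≤ T := ht
  have hint : Integrable (germ H X U f s t - germ H X U f s u) P :=
    ((hmem s t (hsu.trans hut) ht).sub (hmem s u hsu (hut.trans ht))).integrable hp
  obtain ⟨K, hK0, hK⟩ := hU.bound
  have hmX : ∀ v, Measurable (X v) := fun v => ((hX.adapted v).mono (𝓕.le v)).measurable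
  refine (ae_eq_condExp_of_forall_setIntegral_eq (𝓕.le s) ((hmem u t hut ht).integrable hp)
    (fun B _ _ => hint.integrableOn) (fun B hB _ => ?_)
    ((hsm s t (hsu.trans hut) ht).sub (hsm s u hsu (hut.trans ht))).aestronglyMeasurable).symm
  have swap : ∀ v : ℝ≥0, v ≤ u → ∫ ω in B, (∫ r in Set.Icc (u : ℝ) t, H.eval (U v r (f r)) (X v ω)) ∂P
      = ∫ r in Set.Icc (u : ℝ) t, ∫ ω in B, H.eval (U v r (f r)) (X v ω) ∂P := by
    intro v hv
    have hv' : (v : ℝ) ≤ u := hv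
    refine integral_integral_swap_of_caratheodory (F := fun r x => H.eval (U v r (f r)) x)
      (fun x => hU.aemeasurable_eval v.coe_nonneg hv' ht' hf.1 x)
      (hU.continuous_in_space v.coe_nonneg hv' ht' f)
      (integrable_kernel hq hνq v.coe_nonneg (hv'.trans hut') hv' ht' hf K) ?_ (hmX v)
    filter_upwards [ae_Icc_lt (u : ℝ) t] with r hr x
    exact hK (f r) v r v.coe_nonneg (by linarith [hr.1]) (hr.2.trans ht') x
  have e1 : ∀ ω, (germ H X U f s t - germ H X U f s u) ω
      = ∫ r in Set.Icc (u : ℝ) t, H.eval (U s r (f r)) (X s ω) :=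
    fun ω => hU.germ_sub hq hνq hf hsu hut ht ω
  simp_rw [e1]
  rw [swap s hsu]
  have e2 : ∀ ω, germ H X U f u t ω = ∫ r in Set.Icc (u : ℝ) t, H.eval (U u r (f r)) (X u ω) :=
    fun _ => rfl
  simp_rw [e2]
  rw [swap u le_rfl]
  refine integral_congr_ae ?_
  filter_upwards [ae_Icc_lt (u : ℝ) t] with r hr
  have hr0 : 0 ≤ r := u.coe_nonneg.trans hr.1.le
  lift r to ℝ≥0 using hr0
  have hur : u < r := by exact_mod_cast hr.1
  have hrT : r ≤ T := by exact_mod_cast hr.2.trans ht'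
  have hce := hU.condExp_eq s u r (f r) hsu hur hrT
  have hbc := hU.isBoundedContinuous (f r) u r u.coe_nonneg hr.1 (hr.2.trans ht')
  have hi : Integrable (fun ω => H.eval (U u r (f r)) (X u ω)) P := by
    refine Integrable.of_bound
      (((DistributionSpace.continuous_eval hbc).measurable.comp (hmX u)).aestronglyMeasurable)
      (K * ‖f r‖ * ((r : ℝ) - u) ^ (ν / 2)) (Eventually.of_forall fun ω => ?_)
    exact hK (f r) u r u.coe_nonneg hr.1 (hr.2.trans ht') _
  rw [← setIntegral_condExp (𝓕.le s) hi hB]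
  exact setIntegral_congr_ae (𝓕.le s B hB) (by filter_upwards [hce] with ω h _ using h.symm)

theorem PropagatorCondition.germBound [IsProbabilityMeasure P] {m : ℝ}
    (hU : PropagatorCondition P 𝓕 H T ν X U) {q : ℝ≥0∞}
    (hq : 2 < q) (hνq : ν / 2 - (q⁻¹).toReal > -(1 / 2))
    (hf : MemLp f q (volume.restrict (Set.Icc (0 : ℝ) T))) :
    GermBound P m T (germ H X U f) (propagatorNorm H T ν U * (holderConst q (ν / 2)
        * eLpNorm f q (volume.restrict (Set.Icc (0 : ℝ) T)))).toNNReal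
      (1 + ν / 2 - (q⁻¹).toReal) := by
  intro s t hst ht
  have h1 := hU.propagatorNorm_ne_top
  have h2 := hf.eLpNorm_ne_top
  have h3 : holderConst q (ν / 2) ≠ ∞ := ENNReal.ofReal_ne_top
  rw [ENNReal.coe_toNNReal (by finiteness), mul_assoc]
  refine (eLpNorm_le_of_ae_enorm_bound
    (Eventually.of_forall (hU.enorm_germ_le hq hνq hf hst ht))).trans_eq ?_
  simp

end Kernel

/-! ### Comparison of two germs -/

/-- Minkowski's inequality for `[0, ∞]`-valued functions, as the modulus and the coefficients may be
infinite. -/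
theorem eLpNorm_le_add_mul {Ω : Type*} {mΩ : MeasurableSpace Ω} {P : Measure Ω}
    [IsProbabilityMeasure P] {m : ℝ} (hm : 2 ≤ m) {D : Ω → ℝ} {ρ : Ω → ℝ≥0∞} (hρ : Measurable ρ)
    {a b : ℝ≥0∞} (h : ∀ ω, ‖D ω‖ₑ ≤ a + b * ρ ω) :
    eLpNorm D (ENNReal.ofReal m) P ≤ a + b * eLpNorm ρ (ENNReal.ofReal m) P := by
  have hm0 : 0 < m := by linarith
  have h0 : ENNReal.ofReal m ≠ 0 := by simpa using hm0
  rw [eLpNorm_eq_lintegral_rpow_enorm_toReal h0 ENNReal.ofReal_ne_top,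
    eLpNorm_eq_lintegral_rpow_enorm_toReal h0 ENNReal.ofReal_ne_top, ENNReal.toReal_ofReal hm0.le]
  simp only [enorm_eq_self]
  calc (∫⁻ ω, ‖D ω‖ₑ ^ m ∂P) ^ (1 / m)
      ≤ (∫⁻ ω, ((fun _ => a) + (fun ω => b * ρ ω) : Ω → ℝ≥0∞) ω ^ m ∂P) ^ (1 / m) := by
        gcongr with ω
        exact h ω
    _ ≤ (∫⁻ _, a ^ m ∂P) ^ (1 / m) + (∫⁻ ω, (b * ρ ω) ^ m ∂P) ^ (1 / m) :=
        ENNReal.lintegral_Lp_add_le aemeasurable_const (hρ.const_mul b).aemeasurable (by linarith)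
    _ = _ := by
        simp_rw [ENNReal.mul_rpow_of_nonneg _ _ hm0.le]
        rw [lintegral_const, measure_univ, mul_one, lintegral_const_mul _ (hρ.pow_const m),
          ENNReal.mul_rpow_of_nonneg _ _ (by positivity), ← ENNReal.rpow_mul, ← ENNReal.rpow_mul,
          mul_one_div_cancel hm0.ne', ENNReal.rpow_one, ENNReal.rpow_one]

/-- The part of the constant of the comparison estimate which comes from the exponent `γ`. -/
def kernelConst (q : ℝ≥0∞) (T : ℝ≥0) (γ γ' : ℝ) : ℝ≥0∞ :=
  holderConst q (γ / 2) * ENNReal.ofReal ((T : ℝ) ^ (γ / 2 - γ' / 2))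

theorem kernelConst_ne_top (q : ℝ≥0∞) (T : ℝ≥0) (γ γ' : ℝ) : kernelConst q T γ γ' ≠ ∞ :=
  ENNReal.mul_ne_top ENNReal.ofReal_ne_top ENNReal.ofReal_ne_top

/-- Since `t - s ≤ T`, lowering the exponent costs a power of `T`. This brings the `ν` and `ν₁`
terms to the common exponent with `min ν ν₁`. -/
theorem holderConst_mul_le {q : ℝ≥0∞} {T : ℝ≥0} {γ γ' : ℝ} (hγ : γ / 2 - (q⁻¹).toReal > -(1 / 2))
    (hγ' : γ' ≤ γ) {s t : ℝ≥0} (hst : s ≤ t) (ht : t ≤ T) (F : ℝ≥0∞) :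
    holderConst q (γ / 2) * F * ENNReal.ofReal (((t : ℝ) - s) ^ (1 + γ / 2 - (q⁻¹).toReal))
      ≤ kernelConst q T γ γ' * F
        * ENNReal.ofReal (((t : ℝ) - s) ^ (1 + γ' / 2 - (q⁻¹).toReal)) := by
  have hst' : (s : ℝ) ≤ t := hst
  have ht' : (t : ℝ) ≤ T := ht
  have hx : 0 ≤ (t : ℝ) - s := by linarith
  have hxT : (t : ℝ) - s ≤ T := by linarith [s.coe_nonneg]
  generalize (t : ℝ) - s = x at *
  have h1 : x ^ (1 + γ / 2 - (q⁻¹).toReal)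
      ≤ (T : ℝ) ^ (γ / 2 - γ' / 2) * x ^ (1 + γ' / 2 - (q⁻¹).toReal) := by
    rcases hx.eq_or_lt with rfl | hx0
    · rw [Real.zero_rpow (by linarith)]
      positivity
    · rw [show 1 + γ / 2 - (q⁻¹).toReal = (γ / 2 - γ' / 2) + (1 + γ' / 2 - (q⁻¹).toReal) by ring,
        Real.rpow_add hx0]
      gcongr
      linarith
  calc _ ≤ holderConst q (γ / 2) * F * (ENNReal.ofReal ((T : ℝ) ^ (γ / 2 - γ' / 2))
        * ENNReal.ofReal (x ^ (1 + γ' / 2 - (q⁻¹).toReal))) := by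
        rw [← ENNReal.ofReal_mul (by positivity)]
        gcongr
    _ = _ := by unfold kernelConst; ring

section Comparison

variable {d : ℕ} {𝓗 : Type*} [NormedAddCommGroup 𝓗] [NormedSpace ℝ 𝓗] {H : DistributionSpace d 𝓗}
  {Ω : Type*} {mΩ : MeasurableSpace Ω} {P : Measure Ω} {𝓕 : Filtration ℝ≥0 mΩ} {T : ℝ≥0}
  {ν ν₁ : ℝ} {X Y : ℝ≥0 → Ω → Rd d} {UX UY : ℝ → ℝ → 𝓗 →L[ℝ] 𝓗} {f g : ℝ → 𝓗}

theorem enorm_germ_sub_germ_le (hUX : PropagatorCondition P 𝓕 H T ν X UX)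
    (hUY : PropagatorCondition P 𝓕 H T ν Y UY) {q : ℝ≥0∞} (hq : 2 < q)
    (hνq : ν / 2 - (q⁻¹).toReal > -(1 / 2)) (hν₁q : ν₁ / 2 - (q⁻¹).toReal > -(1 / 2))
    (hf : MemLp f q (volume.restrict (Set.Icc (0 : ℝ) T)))
    (hg : MemLp g q (volume.restrict (Set.Icc (0 : ℝ) T))) {s t : ℝ≥0} (hst : s ≤ t) (ht : t ≤ T)
    (ω : Ω) : ‖germ H X UX g s t ω - germ H Y UY f s t ω‖ₑ ≤
      propagatorNorm H T ν UX * (holderConst q (ν / 2)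
        * eLpNorm (f - g) q (volume.restrict (Set.Icc (0 : ℝ) T))
        * ENNReal.ofReal (((t : ℝ) - s) ^ (1 + ν / 2 - (q⁻¹).toReal)))
      + propagatorModulus H T ν₁ UX ‖X s ω - Y s ω‖ * (holderConst q (ν₁ / 2)
        * eLpNorm f q (volume.restrict (Set.Icc (0 : ℝ) T))
        * ENNReal.ofReal (((t : ℝ) - s) ^ (1 + ν₁ / 2 - (q⁻¹).toReal)))
      + propagatorNorm H T ν (UX - UY) * (holderConst q (ν / 2)
        * eLpNorm f q (volume.restrict (Set.Icc (0 : ℝ) T))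
        * ENNReal.ofReal (((t : ℝ) - s) ^ (1 + ν / 2 - (q⁻¹).toReal))) := by
  have hs0 : (0 : ℝ) ≤ s := s.coe_nonneg
  have hst' : (s : ℝ) ≤ t := hst
  have ht' : (t : ℝ) ≤ T := ht
  have hle := Measure.restrict_mono (μ := (volume : Measure ℝ)) (Set.Icc_subset_Icc hs0 ht') le_rfl
  have hfg := hf.sub hg
  have hker : ∀ (u : ℝ → 𝓗) (γ : ℝ),
      AEStronglyMeasurable u (volume.restrict (Set.Icc (0 : ℝ) T)) →
      AEMeasurable (fun r => ‖u r‖ₑ * ENNReal.ofReal ((r - s) ^ (γ / 2)))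
        (volume.restrict (Set.Icc (s : ℝ) t)) := by
    intro u γ hu
    have h1 : Measurable fun r : ℝ => ENNReal.ofReal ((r - s) ^ (γ / 2)) := by fun_prop
    exact (hu.mono_measure hle).enorm.mul h1.aemeasurable
  unfold germ
  rw [← integral_sub (hUX.integrable_eval hq hνq hg hs0 le_rfl hst' ht' (X s ω))
    (hUY.integrable_eval hq hνq hf hs0 le_rfl hst' ht' (Y s ω))]
  refine (enorm_integral_le_lintegral_enorm _).trans ?_
  calc _ ≤ ∫⁻ r in Set.Icc (s : ℝ) t,
        (propagatorNorm H T ν UX * (‖(f - g) r‖ₑ * ENNReal.ofReal ((r - s) ^ (ν / 2)))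
        + propagatorModulus H T ν₁ UX ‖X s ω - Y s ω‖
          * (‖f r‖ₑ * ENNReal.ofReal ((r - s) ^ (ν₁ / 2)))
        + propagatorNorm H T ν (UX - UY)
          * (‖f r‖ₑ * ENNReal.ofReal ((r - s) ^ (ν / 2)))) := by
        refine lintegral_mono_ae ?_
        filter_upwards [ae_Icc_lt (s : ℝ) t] with r hr
        have hrT := hr.2.trans ht'
        have b1 := hUX.isBoundedContinuous (f r) s r hs0 hr.1 hrT
        have b2 := hUX.isBoundedContinuous (g r) s r hs0 hr.1 hrT
        have b3 := hUY.isBoundedContinuous (f r) s r hs0 hr.1 hrT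
        -- Change one ingredient at a time: `g` into `f` at `X`, the point `X` into `Y` under `UX`,
        -- and `UX` into `UY` at `Y`. The three differences are governed by the norm of `UX`, its
        -- modulus, and the distance of the propagators.
        have e : H.eval (UX s r (g r)) (X s ω) - H.eval (UY s r (f r)) (Y s ω)
            = -(H.eval (UX s r ((f - g) r)) (X s ω))
              + (H.eval (UX s r (f r)) (X s ω) - H.eval (UX s r (f r)) (Y s ω))
              + H.eval ((UX - UY) s r (f r)) (Y s ω) := by
          have e1 : (UX - UY) s r (f r) = UX s r (f r) - UY s r (f r) := rfl
          rw [e1, DistributionSpace.eval_sub b1 b3, Pi.sub_apply, map_sub,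
            DistributionSpace.eval_sub b1 b2]
          ring
        rw [e]
        refine (enorm_add_le _ _).trans (add_le_add ((enorm_add_le _ _).trans (add_le_add ?_ ?_)) ?_)
        · rw [enorm_neg]
          exact enorm_eval_le_propagatorNorm _ hs0 hr.1 hrT _
        · exact enorm_eval_sub_le_propagatorModulus _ hs0 hr.1 hrT b1 _ _
        · exact enorm_eval_le_propagatorNorm _ hs0 hr.1 hrT _
    _ = propagatorNorm H T ν UX
          * (∫⁻ r in Set.Icc (s : ℝ) t, ‖(f - g) r‖ₑ * ENNReal.ofReal ((r - s) ^ (ν / 2)))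
        + propagatorModulus H T ν₁ UX ‖X s ω - Y s ω‖
          * (∫⁻ r in Set.Icc (s : ℝ) t, ‖f r‖ₑ * ENNReal.ofReal ((r - s) ^ (ν₁ / 2)))
        + propagatorNorm H T ν (UX - UY)
          * (∫⁻ r in Set.Icc (s : ℝ) t, ‖f r‖ₑ * ENNReal.ofReal ((r - s) ^ (ν / 2))) := by
        have k1 := hker (f - g) ν hfg.1
        have k2 := hker f ν₁ hf.1
        have k3 := hker f ν hf.1
        rw [lintegral_add_right' _ (k3.const_mul _), lintegral_add_right' _ (k2.const_mul _),
          lintegral_const_mul'' _ k1, lintegral_const_mul'' _ k2, lintegral_const_mul'' _ k3]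
    _ ≤ _ := by
        gcongr
        · exact lintegral_kernel_le hq hνq hs0 hst' ht' hfg.1
        · exact lintegral_kernel_le hq hν₁q hs0 hst' ht' hf.1
        · exact lintegral_kernel_le hq hνq hs0 hst' ht' hf.1

theorem eLpNorm_germ_sub_germ_le [IsProbabilityMeasure P] {m : ℝ} (hm : 2 ≤ m)
    (hX : IsMarkovProcess P 𝓕 X) (hY : IsMarkovProcess P 𝓕 Y)
    (hUX : PropagatorCondition P 𝓕 H T ν X UX)
    (hUY : PropagatorCondition P 𝓕 H T ν Y UY) {q : ℝ≥0∞} (hq : 2 < q)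
    (hνq : ν / 2 - (q⁻¹).toReal > -(1 / 2)) (hν₁q : ν₁ / 2 - (q⁻¹).toReal > -(1 / 2))
    (hf : MemLp f q (volume.restrict (Set.Icc (0 : ℝ) T)))
    (hg : MemLp g q (volume.restrict (Set.Icc (0 : ℝ) T))) {s t : ℝ≥0} (hst : s ≤ t) (ht : t ≤ T) :
    eLpNorm ((germ H X UX g - germ H Y UY f) s t) (ENNReal.ofReal m) P ≤
      (kernelConst q T ν (min ν ν₁) + kernelConst q T ν₁ (min ν ν₁))
        * (eLpNorm (f - g) q (volume.restrict (Set.Icc (0 : ℝ) T)) * propagatorNorm H T ν UX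
          + eLpNorm f q (volume.restrict (Set.Icc (0 : ℝ) T))
            * processDist P m T H ν ν₁ X Y UX UY)
        * ENNReal.ofReal (((t : ℝ) - s) ^ (1 + min ν ν₁ / 2 - (q⁻¹).toReal)) := by
  have hmeas : ∀ v, Measurable fun ω => ‖X v ω - Y v ω‖ := fun v =>
    ((((hX.adapted v).sub (hY.adapted v)).mono (𝓕.le v)).norm).measurable
  have hρ : Measurable fun ω => propagatorModulus H T ν₁ UX ‖X s ω - Y s ω‖ :=
    (monotone_propagatorModulus T ν₁ UX).measurable.comp (hmeas s)
  have hR : eLpNorm (fun ω => propagatorModulus H T ν₁ UX ‖X s ω - Y s ω‖) (ENNReal.ofReal m) P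
      ≤ ⨆ (r : ℝ≥0) (_ : r ≤ T),
        eLpNorm (fun ω => propagatorModulus H T ν₁ UX ‖X r ω - Y r ω‖) (ENNReal.ofReal m) P :=
    le_iSup₂_of_le s (hst.trans ht) le_rfl
  have hpt := fun ω => enorm_germ_sub_germ_le hUX hUY hq hνq hν₁q hf hg hst ht ω
  have c1 := holderConst_mul_le hνq (min_le_left ν ν₁) hst ht
  have c2 := holderConst_mul_le hν₁q (min_le_right ν ν₁) hst ht
  unfold processDist
  set R := ⨆ (r : ℝ≥0) (_ : r ≤ T),
        eLpNorm (fun ω => propagatorModulus H T ν₁ UX ‖X r ω - Y r ω‖) (ENNReal.ofReal m) P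
  set N := propagatorNorm H T ν UX
  set N' := propagatorNorm H T ν (UX - UY)
  set F := eLpNorm f q (volume.restrict (Set.Icc (0 : ℝ) T))
  set F' := eLpNorm (f - g) q (volume.restrict (Set.Icc (0 : ℝ) T))
  set τ := ENNReal.ofReal (((t : ℝ) - s) ^ (1 + min ν ν₁ / 2 - (q⁻¹).toReal))
  set κ := kernelConst q T ν (min ν ν₁)
  set κ₁ := kernelConst q T ν₁ (min ν ν₁)
  have h1 := eLpNorm_le_add_mul (P := P) hm (D := (germ H X UX g - germ H Y UY f) s t) hρ
    (a := N * (κ * F' * τ) + N' * (κ * F * τ)) (b := κ₁ * F * τ) (fun ω => by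
      refine (hpt ω).trans ?_
      calc _ ≤ N * (κ * F' * τ) + propagatorModulus H T ν₁ UX ‖X s ω - Y s ω‖ * (κ₁ * F * τ)
            + N' * (κ * F * τ) := by
            gcongr N * ?_ + _ * ?_ + N' * ?_
            · exact c1 F'
            · exact c2 F
            · exact c1 F
        _ = _ := by ring)
  refine h1.trans ?_
  calc N * (κ * F' * τ) + N' * (κ * F * τ) + κ₁ * F * τ * _
      ≤ N * (κ * F' * τ) + N' * (κ * F * τ) + κ₁ * F * τ * R := by gcongr
    _ ≤ N * ((κ + κ₁) * F' * τ) + N' * ((κ + κ₁) * F * τ) + (κ + κ₁) * F * τ * R := by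
        gcongr
        · exact le_self_add
        · exact le_self_add
        · exact le_add_self
    _ = _ := by ring

theorem isUniqueSewing_functional [IsProbabilityMeasure P] {m : ℝ} (hm : 2 ≤ m)
    (hX : IsMarkovProcess P 𝓕 X) (hUX : PropagatorCondition P 𝓕 H T ν X UX) {q : ℝ≥0∞} (hq : 2 < q)
    (hνq : ν / 2 - (q⁻¹).toReal > -(1 / 2))
    (hf : MemLp f q (volume.restrict (Set.Icc (0 : ℝ) T))) :
    IsUniqueSewing P 𝓕 m T (germ H X UX f) (functional P 𝓕 m T H X UX f) := by
  have hgerm := isGerm_germ hm hX hUX hq hνq hf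
  have hex := exists_isSewing hm hgerm (by linarith) (hUX.germBound hq hνq hf)
  have hsew : IsSewing P 𝓕 m T (germ H X UX f) (functional P 𝓕 m T H X UX f) := by
    unfold functional
    rw [dif_pos hex]
    exact hex.choose_spec
  exact ⟨hsew, fun ψ hψ t ht => hsew.ae_eq hm hgerm hψ ht⟩

/-- The constant of the comparison estimate. -/
def comparisonConst (m : ℝ) (T : ℝ≥0) (q : ℝ≥0∞) (ν ν₁ : ℝ) : ℝ≥0∞ :=
  incrementConst m (1 + min ν ν₁ / 2 - (q⁻¹).toReal)
    * (kernelConst q T ν (min ν ν₁) + kernelConst q T ν₁ (min ν ν₁) + 1)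

theorem half_lt_min_exponent {q : ℝ≥0∞} (hνq : ν / 2 - (q⁻¹).toReal > -(1 / 2))
    (hν₁q : ν₁ / 2 - (q⁻¹).toReal > -(1 / 2)) : 1 / 2 < 1 + min ν ν₁ / 2 - (q⁻¹).toReal := by
  rcases min_cases ν ν₁ with ⟨h, _⟩ | ⟨h, _⟩ <;> rw [h] <;> linarith

theorem comparisonConst_ne_top (m : ℝ) (T : ℝ≥0) {q : ℝ≥0∞}
    (hνq : ν / 2 - (q⁻¹).toReal > -(1 / 2)) (hν₁q : ν₁ / 2 - (q⁻¹).toReal > -(1 / 2)) :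
    comparisonConst m T q ν ν₁ ≠ ∞ := by
  have h1 := kernelConst_ne_top q T ν (min ν ν₁)
  have h2 := kernelConst_ne_top q T ν₁ (min ν ν₁)
  have h3 := incrementConst_ne_top (m := m) (half_lt_min_exponent hνq hν₁q)
  unfold comparisonConst
  finiteness

/-- The difference of the two processes is a sewing of the difference of the germs, which is again a
germ; the sharp increment bound applies with `Γ` the comparison estimate of the germs. -/
theorem eLpNorm_functional_sub_functional_le [IsProbabilityMeasure P] {m : ℝ} (hm : 2 ≤ m)
    (hX : IsMarkovProcess P 𝓕 X) (hY : IsMarkovProcess P 𝓕 Y)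
    (hUX : PropagatorCondition P 𝓕 H T ν X UX)
    (hUY : PropagatorCondition P 𝓕 H T ν Y UY) {q : ℝ≥0∞} (hq : 2 < q)
    (hνq : ν / 2 - (q⁻¹).toReal > -(1 / 2)) (hν₁q : ν₁ / 2 - (q⁻¹).toReal > -(1 / 2))
    (hf : MemLp f q (volume.restrict (Set.Icc (0 : ℝ) T)))
    (hg : MemLp g q (volume.restrict (Set.Icc (0 : ℝ) T))) {s t : ℝ≥0} (hst : s ≤ t) (ht : t ≤ T) :
    eLpNorm (fun ω => functional P 𝓕 m T H X UX g t ω - functional P 𝓕 m T H X UX g s ω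
        - functional P 𝓕 m T H Y UY f t ω + functional P 𝓕 m T H Y UY f s ω)
        (ENNReal.ofReal m) P
      ≤ comparisonConst m T q ν ν₁
        * (eLpNorm (f - g) q (volume.restrict (Set.Icc (0 : ℝ) T)) * propagatorNorm H T ν UX
          + eLpNorm f q (volume.restrict (Set.Icc (0 : ℝ) T))
            * processDist P m T H ν ν₁ X Y UX UY)
        * ENNReal.ofReal (((t : ℝ) - s) ^ (1 + min ν ν₁ / 2 - (q⁻¹).toReal)) := by
  have hα2 := half_lt_min_exponent hνq hν₁q
  unfold comparisonConst
  set α := 1 + min ν ν₁ / 2 - (q⁻¹).toReal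
  have hκtop : kernelConst q T ν (min ν ν₁) + kernelConst q T ν₁ (min ν ν₁) + 1 ≠ ∞ := by
    have h1 := kernelConst_ne_top q T ν (min ν ν₁)
    have h2 := kernelConst_ne_top q T ν₁ (min ν ν₁)
    finiteness
  set κ := kernelConst q T ν (min ν ν₁) + kernelConst q T ν₁ (min ν ν₁) + 1
  have hφ := isUniqueSewing_functional hm hX hUX hq hνq hg
  have hψ := isUniqueSewing_functional hm hY hUY hq hνq hf
  have hgX := isGerm_germ hm hX hUX hq hνq hg
  have hgY := isGerm_germ hm hY hUY hq hνq hf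
  have hsew := hφ.1.sub hm (fun s t h1 h2 => hgX.integrable hm h1 h2)
    (fun s t h1 h2 => hgY.integrable hm h1 h2) hψ.1
  have hgerm := hgX.sub hm hgY
  set Δ := eLpNorm (f - g) q (volume.restrict (Set.Icc (0 : ℝ) T)) * propagatorNorm H T ν UX
    + eLpNorm f q (volume.restrict (Set.Icc (0 : ℝ) T)) * processDist P m T H ν ν₁ X Y UX UY
    with hΔ
  have hbound : ∀ s t : ℝ≥0, s ≤ t → t ≤ T →
      eLpNorm ((germ H X UX g - germ H Y UY f) s t) (ENNReal.ofReal m) P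
        ≤ κ * Δ * ENNReal.ofReal (((t : ℝ) - s) ^ α) := by
    intro s t hst ht
    refine (eLpNorm_germ_sub_germ_le hm hX hY hUX hUY hq hνq hν₁q hf hg hst ht).trans ?_
    gcongr
    exact le_self_add
  have e : (fun ω => functional P 𝓕 m T H X UX g t ω - functional P 𝓕 m T H X UX g s ω
      - functional P 𝓕 m T H Y UY f t ω + functional P 𝓕 m T H Y UY f s ω)
      = (functional P 𝓕 m T H X UX g - functional P 𝓕 m T H Y UY f) t
        - (functional P 𝓕 m T H X UX g - functional P 𝓕 m T H Y UY f) s := by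
    ext ω
    simp only [Pi.sub_apply]
    ring
  rw [e]
  -- The distance may be infinite. Then for `s < t` the right side is `∞`, because the `1` in each
  -- factor of the constant keeps it nonzero; for `s = t` the left side is zero.
  rcases eq_or_ne Δ ∞ with hΔtop | hΔtop
  · rcases hst.eq_or_lt with rfl | hlt
    · rw [sub_self, eLpNorm_zero]
      exact bot_le
    · have hpos : 0 < ((t : ℝ) - s) ^ α := Real.rpow_pos_of_pos (sub_pos.2 hlt) _
      have h1 : incrementConst m α ≠ 0 := by
        unfold incrementConst
        exact (one_pos.trans_le le_self_add).ne'
      have h2 : κ ≠ 0 := (one_pos.trans_le le_add_self).ne'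
      rw [hΔtop, ENNReal.mul_top (mul_ne_zero h1 h2), ENNReal.top_mul (by simpa using hpos)]
      exact le_top
  · have hΓ : GermBound P m T (germ H X UX g - germ H Y UY f) (κ * Δ).toNNReal α := by
      intro s t hst ht
      rw [ENNReal.coe_toNNReal (by finiteness)]
      exact hbound s t hst ht
    refine (hsew.eLpNorm_sub_le hm hgerm hα2 hΓ hst ht).trans_eq ?_
    rw [ENNReal.coe_toNNReal (by finiteness)]
    ring

end Comparison

end DistFunctional

end

theorem proposition3p9 (m : ℝ) (hm : 2 ≤ m) (T : ℝ≥0) (hT : 0 < T)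
    (q : ℝ≥0∞) (hq : 2 < q) (ν ν₁ : ℝ) (hν : ν ≤ 0) (hν₁ : ν₁ ≤ 0)
    (hνq : ν / 2 - (q⁻¹).toReal > -(1 / 2)) (hν₁q : ν₁ / 2 - (q⁻¹).toReal > -(1 / 2)) :
    ∃ C : ℝ≥0, ∀ (d : ℕ) (_ : 1 ≤ d)
      (𝓗 : Type*) [NormedAddCommGroup 𝓗] [NormedSpace ℝ 𝓗]
      (H : DistFunctional.DistributionSpace d 𝓗)
      (Ω : Type*) [mΩ : MeasurableSpace Ω] (P : Measure Ω) [IsProbabilityMeasure P]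
      [P.IsComplete] (𝓕 : Filtration ℝ≥0 mΩ)
      (_ : ∀ N : Set Ω, P N = 0 → MeasurableSet[𝓕 0] N)
      (X Y : ℝ≥0 → Ω → DistFunctional.Rd d) (UX UY : ℝ → ℝ → 𝓗 →L[ℝ] 𝓗)
      (_ : DistFunctional.IsMarkovProcess P 𝓕 X) (_ : DistFunctional.IsMarkovProcess P 𝓕 Y)
      (_ : DistFunctional.PropagatorCondition P 𝓕 H T ν X UX)
      (_ : DistFunctional.PropagatorCondition P 𝓕 H T ν Y UY)
      (_ : ∀ δ : ℝ, 0 < δ → DistFunctional.propagatorModulus H T ν₁ UX δ < ∞)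
      (f g : ℝ → 𝓗)
      (_ : MemLp f q (volume.restrict (Set.Icc (0 : ℝ) T)))
      (_ : MemLp g q (volume.restrict (Set.Icc (0 : ℝ) T))),
      DistFunctional.IsUniqueSewing P 𝓕 m T (DistFunctional.germ H X UX g)
          (DistFunctional.functional P 𝓕 m T H X UX g) ∧
      DistFunctional.IsUniqueSewing P 𝓕 m T (DistFunctional.germ H Y UY f)
          (DistFunctional.functional P 𝓕 m T H Y UY f) ∧
      ∀ s t : ℝ≥0, s ≤ t → t ≤ T →
        eLpNorm (fun ω =>
            DistFunctional.functional P 𝓕 m T H X UX g t ω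
              - DistFunctional.functional P 𝓕 m T H X UX g s ω
              - DistFunctional.functional P 𝓕 m T H Y UY f t ω
              + DistFunctional.functional P 𝓕 m T H Y UY f s ω) (ENNReal.ofReal m) P
          ≤ C * (eLpNorm (f - g) q (volume.restrict (Set.Icc (0 : ℝ) T))
                  * DistFunctional.propagatorNorm H T ν UX
                + eLpNorm f q (volume.restrict (Set.Icc (0 : ℝ) T))
                  * DistFunctional.processDist P m T H ν ν₁ X Y UX UY)
              * ENNReal.ofReal (((t : ℝ) - s) ^ (1 + min ν ν₁ / 2 - (q⁻¹).toReal)) := by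
  refine ⟨(DistFunctional.comparisonConst m T q ν ν₁).toNNReal, ?_⟩
  intro d _ 𝓗 _ _ H Ω mΩ P _ _ 𝓕 _ X Y UX UY hX hY hUX hUY _ f g hf hg
  refine ⟨DistFunctional.isUniqueSewing_functional hm hX hUX hq hνq hg,
    DistFunctional.isUniqueSewing_functional hm hY hUY hq hνq hf, fun s t hst ht => ?_⟩
  rw [ENNReal.coe_toNNReal (DistFunctional.comparisonConst_ne_top m T hνq hν₁q)]
  exact DistFunctional.eLpNorm_functional_sub_functional_le hm hX hY hUX hUY hq hνq hν₁q hf hg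
    hst ht
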